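/- Let $\Bbbk$ be a field of characteristic $0$. Sumless Sweedler notation is used throughout. **Weak Hopf algebras and integrals.** A weak Hopf algebra over $\Bbbk$ is a unital associative $\Bbbk$-algebra $H$ which is also a $\Bbbk$-coalgebra $(H,\Delta,\varepsilon)$, such that for all $a,b,c\in H$ $$\Delta(ab)=\Delta(a)\Delta(b),\qquad \varepsilon(abc)=\varepsilon(ab_1)\varepsilon(b_2c)=\varepsilon(ab_2)\varepsilon(b_1c),$$ $$\Delta^2(1)=(\Delta(1)\otimes 1)(1\otimes\Delta(1))=(1\otimes\Delta(1))(\Delta(1)\otimes 1),$$ together with a linear map $S:H\to H$ satisfying $S(h_1)h_2=1_1\varepsilon(h1_2)$, $h_1S(h_2)=\varepsilon_t(h)$ and $S(h_1)h_2S(h_3)=S(h)$ for all $h\in H$, where $\varepsilon_t(h):=\varepsilon(1_1h)1_2$. An element $\Lambda\in H$ is a left integral if $h\Lambda=\varepsilon_t(h)\Lambda$ for all $h\in H$; it is non-degenerate if the linear map $\Psi_\Lambda:H^*\to H$, $\phi\mapsto\Lambda_1\phi(\Lambda_2)$, is bijective. **Data.** Let $L$ be a finite-dimensional Hopf algebra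 over $\Bbbk$ with comultiplication $\Delta_L$, counit $\varepsilon_L$ and antipode $S_L$ (which is then bijective). Let $B$ be a finite-dimensional (unital, associative) $\Bbbk$-algebra which is strongly separable, with symmetric separability idempotent $e^1\otimes e^2\in B\otimes B$, i.e. $$be^1\otimes e^2=e^1\otimes e^2b\ \ (b\in B),\qquad e^1e^2=1_B,\qquad e^1\otimes e^2=e^2\otimes e^1,$$ and let $\omega:B\to\Bbbk$ be the (unique) linear form with $\omega(e^1)e^2=1_B=e^1\omega(e^2)$. Let $\triangleleft:B\otimes L\to B$ make $B$ a right $L$-module algebra, i.e. $$(b\triangleleft\ell)\triangleleft\ell'=b\triangleleft(\ell\ell'),\quad b\triangleleft 1_L=b,\quad (bb')\triangleleft\ell=(b\triangleleft\ell_1)(b'\triangleleft\ell_2),\quad 1_B\triangleleft\ell=\varepsilon_L(\ell)1_B,$$ and assume that $(e^1\triangleleft\ell)\otimes e^2=e^1\otimes(e^2\triangleleft S_L(\ell))$ for all $\ell\in L$. **The quantum transformation groupoid.** Let $H(L,B)$ be the weak Hopf algebra with underlying vector space $B^{op}\otimes L\otimes B$, unit $1_B\otimes1_L\otimes1_B$,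 and $$(a\otimes\ell\otimes b)(a'\otimes\ell'\otimes b')=(a'\triangleleft S_L(\ell_1))a\otimes\ell_2\ell'_1\otimes(b\triangleleft\ell'_2)b',$$ $$\Delta(a\otimes\ell\otimes b)=(a\otimes\ell_1\otimes e^1)\otimes\big((e^2\triangleleft S_L(\ell_2))\otimes\ell_3\otimes b\big),$$ $$\varepsilon(a\otimes\ell\otimes b)=\omega\big(a(b\triangleleft S_L^{-1}(\ell))\big),\qquad S(a\otimes\ell\otimes b)=b\otimes S_L(\ell)\otimes a,$$ where all products of elements of $B$ are taken in $B$ (not in $B^{op}$). **Proposition.** Let $\Lambda\in L$ be a right integral of $L$, i.e. $\Lambda\ell=\varepsilon_L(\ell)\Lambda$ for all $\ell\in L$. Then $$\bar\Lambda:=(e^1\triangleleft\Lambda_1)\otimes S_L(\Lambda_2)\otimes e^2$$ is a left integral of $H(L,B)$, and if $\Lambda\neq0$ then $\bar\Lambda$ is non-degenerate. -/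

import Mathlib

open scoped TensorProduct
open Coalgebra HopfAlgebra

/-! ### Sweedler notation -/

attribute [fun_prop] IsLinearMap

/-- Sweedler notation. For `t = ∑ᵢ uᵢ ⊗ vᵢ`, written `t¹ ⊗ t²` without the sum, `sweedler f t` is
`f(t¹, t²) := ∑ᵢ f(uᵢ, vᵢ)`. It is only used for bilinear `f`, where it does not depend on the way
`t` is written as a sum of pure tensors (see `sweedler_eq_lift`). -/
noncomputable def sweedler {k U V M : Type*} [Field k] [AddCommGroup U] [Module k U]
    [AddCommGroup V] [Module k V] [AddCommGroup M] (f : U → V → M) (t : U ⊗[k] V) : M :=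
  ∑ p ∈ (TensorProduct.exists_finset t).choose, f p.1 p.2

namespace Sweedler

section General

variable {k U V W M N X A : Type*} [Field k] [AddCommGroup U] [Module k U]
  [AddCommGroup V] [Module k V] [AddCommGroup W] [Module k W] [AddCommGroup M] [Module k M]
  [AddCommGroup N] [Module k N] [AddCommGroup X] [Module k X] [Ring A] [Algebra k A]

@[fun_prop] theorem lin_id : IsLinearMap k (fun x : U => x) := ⟨fun _ _ => rfl, fun _ _ => rfl⟩

@[fun_prop] theorem lin_comp {f : V → W} {g : U → V} (hf : IsLinearMap k f)
    (hg : IsLinearMap k g) : IsLinearMap k (fun x => f (g x)) :=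
  ⟨fun x y => by rw [hg.map_add, hf.map_add], fun c x => by rw [hg.map_smul, hf.map_smul]⟩

@[fun_prop] theorem lin_lm (φ : V →ₗ[k] W) : IsLinearMap k (fun x => φ x) := φ.isLinear

@[fun_prop] theorem lin_app {g : U → V →ₗ[k] W} (hg : IsLinearMap k g) (v : V) :
    IsLinearMap k (fun x => g x v) :=
  ⟨fun x y => by rw [hg.map_add]; rfl, fun c x => by rw [hg.map_smul]; rfl⟩

@[fun_prop] theorem lin_mul_l {g : U → A} (hg : IsLinearMap k g) (v : A) :
    IsLinearMap k (fun x => g x * v) :=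
  ⟨fun x y => by rw [hg.map_add, add_mul], fun c x => by rw [hg.map_smul, smul_mul_assoc]⟩

@[fun_prop] theorem lin_mul_r {g : U → A} (hg : IsLinearMap k g) (v : A) :
    IsLinearMap k (fun x => v * g x) :=
  ⟨fun x y => by rw [hg.map_add, mul_add], fun c x => by rw [hg.map_smul, mul_smul_comm]⟩

@[fun_prop] theorem lin_smul_l {g : U → k} (hg : IsLinearMap k g) (v : M) :
    IsLinearMap k (fun x => g x • v) :=
  ⟨fun x y => by rw [hg.map_add, add_smul], fun c x => by rw [hg.map_smul, smul_assoc]⟩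

@[fun_prop] theorem lin_smul_r {g : U → M} (hg : IsLinearMap k g) (v : k) :
    IsLinearMap k (fun x => v • g x) :=
  ⟨fun x y => by rw [hg.map_add, smul_add], fun c x => by rw [hg.map_smul, smul_comm]⟩

@[fun_prop] theorem lin_tmul_l {g : U → M} (hg : IsLinearMap k g) (v : N) :
    IsLinearMap k (fun x => g x ⊗ₜ[k] v) :=
  ⟨fun x y => by rw [hg.map_add, TensorProduct.add_tmul],
    fun c x => by rw [hg.map_smul, TensorProduct.smul_tmul']⟩

@[fun_prop] theorem lin_tmul_r {g : U → M} (hg : IsLinearMap k g) (v : N) :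
    IsLinearMap k (fun x => v ⊗ₜ[k] g x) :=
  ⟨fun x y => by rw [hg.map_add, TensorProduct.tmul_add],
    fun c x => by rw [hg.map_smul, TensorProduct.tmul_smul]⟩

@[fun_prop] theorem lin_sweedler_f {f : X → U → V → M}
    (hf : ∀ u v, IsLinearMap k (fun x => f x u v)) (t : U ⊗[k] V) :
    IsLinearMap k (fun x => sweedler (f x) t) :=
  ⟨fun x y => by simp [sweedler, (hf _ _).map_add, Finset.sum_add_distrib],
    fun c x => by simp [sweedler, (hf _ _).map_smul, Finset.smul_sum]⟩

theorem sweedler_eq_lift {f : U → V → M} (h1 : ∀ v, IsLinearMap k (fun u => f u v))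
    (h2 : ∀ u, IsLinearMap k (fun v => f u v)) (t : U ⊗[k] V) :
    sweedler f t = TensorProduct.lift (LinearMap.mk₂ k f (fun _ _ v => (h1 v).map_add _ _)
      (fun _ _ v => (h1 v).map_smul _ _) (fun u => (h2 u).map_add)
      (fun _ u _ => (h2 u).map_smul _ _)) t := by
  conv_rhs => rw [(TensorProduct.exists_finset t).choose_spec]
  simp [sweedler]

@[fun_prop] theorem lin_sweedler_t {f : U → V → M} {g : X → U ⊗[k] V}
    (h1 : ∀ v, IsLinearMap k (fun u => f u v)) (h2 : ∀ u, IsLinearMap k (fun v => f u v))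
    (hg : IsLinearMap k g) : IsLinearMap k (fun x => sweedler f (g x)) := by
  simp only [sweedler_eq_lift h1 h2]; fun_prop

theorem sweedler_tmul {f : U → V → M} (h1 : ∀ v, IsLinearMap k (fun u => f u v))
    (h2 : ∀ u, IsLinearMap k (fun v => f u v)) (u : U) (v : V) :
    sweedler f (u ⊗ₜ[k] v) = f u v := by
  simp [sweedler_eq_lift h1 h2]

theorem map_sweedler {φ : M → N} (hφ : IsLinearMap k φ) (f : U → V → M) (t : U ⊗[k] V) :
    φ (sweedler f t) = sweedler (fun u v => φ (f u v)) t :=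
  map_sum hφ.mk' _ _

theorem lm_sweedler (φ : M →ₗ[k] N) (f : U → V → M) (t : U ⊗[k] V) :
    φ (sweedler f t) = sweedler (fun u v => φ (f u v)) t := map_sum φ _ _

theorem le_sweedler (φ : M ≃ₗ[k] N) (f : U → V → M) (t : U ⊗[k] V) :
    φ (sweedler f t) = sweedler (fun u v => φ (f u v)) t := map_sum φ _ _

theorem app_sweedler (f : U → V → M →ₗ[k] N) (t : U ⊗[k] V) (m : M) :
    (sweedler f t) m = sweedler (fun u v => f u v m) t := by
  simp [sweedler, LinearMap.sum_apply]

theorem sweedler_mul (f : U → V → A) (t : U ⊗[k] V) (a : A) :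
    sweedler f t * a = sweedler (fun u v => f u v * a) t := Finset.sum_mul ..

theorem mul_sweedler (f : U → V → A) (t : U ⊗[k] V) (a : A) :
    a * sweedler f t = sweedler (fun u v => a * f u v) t := Finset.mul_sum ..

theorem smul_sweedler (f : U → V → M) (t : U ⊗[k] V) (a : k) :
    a • sweedler f t = sweedler (fun u v => a • f u v) t := Finset.smul_sum

theorem sweedler_smul (f : U → V → k) (t : U ⊗[k] V) (a : M) :
    sweedler f t • a = sweedler (fun u v => f u v • a) t := Finset.sum_smul

theorem tmul_sweedler (f : U → V → M) (t : U ⊗[k] V) (a : N) :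
    a ⊗ₜ[k] sweedler f t = sweedler (fun u v => a ⊗ₜ[k] f u v) t := TensorProduct.tmul_sum ..

theorem sweedler_tmul' (f : U → V → M) (t : U ⊗[k] V) (a : N) :
    sweedler f t ⊗ₜ[k] a = sweedler (fun u v => f u v ⊗ₜ[k] a) t := TensorProduct.sum_tmul ..

theorem sweedler_self (t : U ⊗[k] V) : sweedler (fun u v => u ⊗ₜ[k] v) t = t :=
  (TensorProduct.exists_finset t).choose_spec.symm

theorem sweedler_comm {U' V' : Type*} [AddCommGroup U'] [Module k U'] [AddCommGroup V']
    [Module k V'] (f : U → V → U' → V' → M) (t : U ⊗[k] V) (s : U' ⊗[k] V') :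
    sweedler (fun a b => sweedler (fun c d => f a b c d) s) t =
      sweedler (fun c d => sweedler (fun a b => f a b c d) t) s :=
  Finset.sum_comm

/-- Apply a linear map to an identity between tensors. -/
theorem sweedler_sweedler {U' V' : Type*} [AddCommGroup U'] [Module k U'] [AddCommGroup V']
    [Module k V'] {f : U → V → M} (h1 : ∀ v, IsLinearMap k (fun u => f u v))
    (h2 : ∀ u, IsLinearMap k (fun v => f u v)) (g : U' → V' → U ⊗[k] V) (t : U' ⊗[k] V') :
    sweedler f (sweedler g t) = sweedler (fun a b => sweedler f (g a b)) t :=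
  map_sweedler (φ := fun t => sweedler f t) (by fun_prop) g t

end General

section Coalg

variable {k L M : Type*} [Field k] [AddCommGroup M] [Module k M]

section
variable [AddCommGroup L] [Module k L] [Coalgebra k L]

theorem sw_coassoc {f : L → L → L → M} (h1 : ∀ y z, IsLinearMap k (fun x => f x y z))
    (h2 : ∀ x z, IsLinearMap k (fun y => f x y z)) (h3 : ∀ x y, IsLinearMap k (fun z => f x y z))
    (ℓ : L) :
    sweedler (fun u z => sweedler (fun x y => f x y z) (comul (R := k) u)) (comul (R := k) ℓ) =
      sweedler (fun x v => sweedler (fun y z => f x y z) (comul (R := k) v))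
        (comul (R := k) ℓ) := by
  have key := congrArg (fun t => sweedler (fun x p => sweedler (fun y z => f x y z) p) t)
    (coassoc_apply (R := k) ℓ)
  rw [← sweedler_self (comul (R := k) ℓ)] at key
  simp only [lm_sweedler, le_sweedler, LinearMap.rTensor_tmul, LinearMap.lTensor_tmul] at key
  have e1 : ∀ u z : L, TensorProduct.assoc k L L L (comul (R := k) u ⊗ₜ[k] z) =
      sweedler (fun x y => x ⊗ₜ[k] (y ⊗ₜ[k] z)) (comul (R := k) u) := by
    intro u z
    conv_lhs => rw [← sweedler_self (comul (R := k) u)]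
    rw [sweedler_tmul', le_sweedler]; rfl
  simp only [e1] at key
  simp (disch := fun_prop) only [sweedler_sweedler, sweedler_tmul] at key
  exact key

theorem sw_counit_l {f : L → M} (hf : IsLinearMap k f) (ℓ : L) :
    sweedler (fun x y => counit (R := k) x • f y) (comul (R := k) ℓ) = f ℓ := by
  have key := congrArg (fun t => sweedler (fun c y => c • f y) t)
    (rTensor_counit_comul (R := k) ℓ)
  simp (disch := fun_prop) only [sweedler_tmul, one_smul] at key
  rw [← key]
  conv_rhs => rw [← sweedler_self (comul (R := k) ℓ), lm_sweedler]
  simp (disch := fun_prop) only [sweedler_sweedler, LinearMap.rTensor_tmul, sweedler_tmul]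

theorem sw_counit_r {f : L → M} (hf : IsLinearMap k f) (ℓ : L) :
    sweedler (fun x y => counit (R := k) y • f x) (comul (R := k) ℓ) = f ℓ := by
  have key := congrArg (fun t => sweedler (fun y c => c • f y) t)
    (lTensor_counit_comul (R := k) ℓ)
  simp (disch := fun_prop) only [sweedler_tmul, one_smul] at key
  rw [← key]
  conv_rhs => rw [← sweedler_self (comul (R := k) ℓ), lm_sweedler]
  simp (disch := fun_prop) only [sweedler_sweedler, LinearMap.lTensor_tmul, sweedler_tmul]

end

section
variable [Ring L] [HopfAlgebra k L]

theorem sw_mul {f : L → L → M} (h1 : ∀ y, IsLinearMap k (fun x => f x y))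
    (h2 : ∀ x, IsLinearMap k (fun y => f x y)) (a b : L) :
    sweedler f (comul (R := k) (a * b)) = sweedler (fun a₁ a₂ => sweedler
      (fun b₁ b₂ => f (a₁ * b₁) (a₂ * b₂)) (comul (R := k) b)) (comul (R := k) a) := by
  rw [Bialgebra.comul_mul]
  conv_lhs => rw [← sweedler_self (comul (R := k) a), ← sweedler_self (comul (R := k) b)]
  simp only [sweedler_mul, mul_sweedler]
  simp (disch := fun_prop) only [sweedler_sweedler, Algebra.TensorProduct.tmul_mul_tmul,
    sweedler_tmul]
  exact sweedler_comm ..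

theorem sw_one {f : L → L → M} (h1 : ∀ y, IsLinearMap k (fun x => f x y))
    (h2 : ∀ x, IsLinearMap k (fun y => f x y)) :
    sweedler f (comul (R := k) (1 : L)) = f 1 1 := by
  rw [Bialgebra.comul_one, Algebra.TensorProduct.one_def, sweedler_tmul h1 h2]

theorem sw_antipode_l {f : L → M} (hf : IsLinearMap k f) (ℓ : L) :
    sweedler (fun x y => f (antipode k x * y)) (comul (R := k) ℓ) =
      counit (R := k) ℓ • f 1 := by
  have key := congrArg f (mul_antipode_rTensor_comul_apply (R := k) ℓ)
  rw [Algebra.algebraMap_eq_smul_one, hf.map_smul] at key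
  rw [← key]
  conv_rhs => rw [← sweedler_self (comul (R := k) ℓ), lm_sweedler, lm_sweedler, map_sweedler hf]
  rfl

theorem sw_antipode_r {f : L → M} (hf : IsLinearMap k f) (ℓ : L) :
    sweedler (fun x y => f (x * antipode k y)) (comul (R := k) ℓ) =
      counit (R := k) ℓ • f 1 := by
  have key := congrArg f (mul_antipode_lTensor_comul_apply (R := k) ℓ)
  rw [Algebra.algebraMap_eq_smul_one, hf.map_smul] at key
  rw [← key]
  conv_rhs => rw [← sweedler_self (comul (R := k) ℓ), lm_sweedler, lm_sweedler, map_sweedler hf]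
  rfl

/-- The antipode is anti-comultiplicative. -/
theorem comul_antipode (ℓ : L) :
    comul (R := k) (antipode k ℓ) =
      sweedler (fun x y => antipode k y ⊗ₜ[k] antipode k x) (comul (R := k) ℓ) := by
  -- both sides are convolution inverses of `comul`
  have hT : ∀ u : L, sweedler (fun x y => sweedler (fun a b => antipode k b ⊗ₜ[k] antipode k a)
      (comul (R := k) x) * comul (R := k) y) (comul (R := k) u) = counit (R := k) u • 1 := by
    intro u
    have e : ∀ x y : L, sweedler (fun a b => antipode k b ⊗ₜ[k] antipode k a)
        (comul (R := k) x) * comul (R := k) y = sweedler (fun a b => sweedler (fun c d =>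
          (antipode k b * c) ⊗ₜ[k] (antipode k a * d)) (comul (R := k) y))
          (comul (R := k) x) := by
      intro x y
      conv_lhs => rw [← sweedler_self (comul (R := k) y)]
      simp only [sweedler_mul, mul_sweedler, Algebra.TensorProduct.tmul_mul_tmul]
      exact sweedler_comm ..
    simp only [e]
    rw [sw_coassoc (by fun_prop) (by fun_prop) (by fun_prop)]
    have e2 : ∀ a v : L, sweedler (fun b w => sweedler (fun c d =>
          (antipode k b * c) ⊗ₜ[k] (antipode k a * d)) (comul (R := k) w)) (comul (R := k) v) =
          (1 : L) ⊗ₜ[k] (antipode k a * v) := by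
      intro a v
      rw [← sw_coassoc (by fun_prop) (by fun_prop) (by fun_prop)]
      have : ∀ u d : L, sweedler (fun x y => (antipode k x * y) ⊗ₜ[k] (antipode k a * d))
          (comul (R := k) u) = counit (R := k) u • (1 : L) ⊗ₜ[k] (antipode k a * d) :=
        fun u d => sw_antipode_l (f := fun t => t ⊗ₜ[k] (antipode k a * d)) (by fun_prop) u
      simp only [this]
      exact sw_counit_l (f := fun d => (1 : L) ⊗ₜ[k] (antipode k a * d)) (by fun_prop) v
    simp only [e2]
    exact sw_antipode_l (f := fun t => (1 : L) ⊗ₜ[k] t) (by fun_prop) u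
  have h1 : sweedler (fun u z => sweedler (fun x y =>
      sweedler (fun a b => antipode k b ⊗ₜ[k] antipode k a) (comul (R := k) x) *
        (comul (R := k) (y * antipode k z))) (comul (R := k) u)) (comul (R := k) ℓ) =
      comul (R := k) (antipode k ℓ) := by
    simp only [Bialgebra.comul_mul, ← mul_assoc, ← sweedler_mul, hT, smul_mul_assoc, one_mul]
    exact sw_counit_l (f := fun d => comul (R := k) (antipode k d)) (by fun_prop) ℓ
  rw [← h1, sw_coassoc (by fun_prop) (by fun_prop) (by fun_prop)]
  have h2 : ∀ x v : L, sweedler (fun y z => sweedler (fun a b => antipode k b ⊗ₜ[k] antipode k a)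
      (comul (R := k) x) * (comul (R := k) (y * antipode k z))) (comul (R := k) v) =
      counit (R := k) v • sweedler (fun a b => antipode k b ⊗ₜ[k] antipode k a)
        (comul (R := k) x) := by
    intro x v
    rw [sw_antipode_r (f := fun t => sweedler (fun a b => antipode k b ⊗ₜ[k] antipode k a)
      (comul (R := k) x) * comul (R := k) t) (by fun_prop)]
    simp
  simp only [h2]
  exact sw_counit_r (by fun_prop) ℓ

theorem sw_antipode {f : L → L → M} (h1 : ∀ y, IsLinearMap k (fun x => f x y))
    (h2 : ∀ x, IsLinearMap k (fun y => f x y)) (ℓ : L) :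
    sweedler f (comul (R := k) (antipode k ℓ)) =
      sweedler (fun x y => f (antipode k y) (antipode k x)) (comul (R := k) ℓ) := by
  rw [comul_antipode]
  simp (disch := fun_prop) only [sweedler_sweedler, sweedler_tmul]

end

end Coalg

end Sweedler

namespace Sweedler

section AntipodeBijective

variable {k L : Type*} [Field k] [Ring L] [HopfAlgebra k L]

theorem antipode_pow_mul (n : ℕ) :
    (∀ a b : L, ((antipode k : L →ₗ[k] L) ^ n) (a * b) =
      ((antipode k : L →ₗ[k] L) ^ n) a * ((antipode k : L →ₗ[k] L) ^ n) b) ∨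
    (∀ a b : L, ((antipode k : L →ₗ[k] L) ^ n) (a * b) =
      ((antipode k : L →ₗ[k] L) ^ n) b * ((antipode k : L →ₗ[k] L) ^ n) a) := by
  induction n with
  | zero => left; intro a b; rfl
  | succ n ih =>
    rcases ih with h | h
    · right; intro a b
      simp only [pow_succ', Module.End.mul_apply, h, antipode_mul_antidistrib]
    · left; intro a b
      simp only [pow_succ', Module.End.mul_apply, h, antipode_mul_antidistrib]

/-- One cancellation step: a coalgebra map `p` with `F S p = F S` satisfies `F p = F`. -/
theorem antipode_cancel (F p : L →ₗ[k] L)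
    (hF : (∀ a b, F (a * b) = F a * F b) ∨ (∀ a b, F (a * b) = F b * F a))
    (hp : ∀ x, comul (R := k) (p x) = sweedler (fun a b => p a ⊗ₜ[k] p b) (comul (R := k) x))
    (hε : ∀ x, counit (R := k) (p x) = counit (R := k) x)
    (h : ∀ x, F (antipode k (p x)) = F (antipode k x)) (x : L) : F (p x) = F x := by
  have e1 : ∀ u : L, sweedler (fun a b => p a * antipode k (p b)) (comul (R := k) u) =
      counit (R := k) u • (1 : L) := by
    intro u
    rw [← hε, ← sw_antipode_r (f := fun t : L => t) (by fun_prop) (p u), hp]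
    simp (disch := fun_prop) only [sweedler_sweedler, sweedler_tmul]
  have e2 : ∀ v : L, sweedler (fun b c => F (antipode k (p b) * c)) (comul (R := k) v) =
      counit (R := k) v • F 1 := by
    intro v
    rw [← sw_antipode_l (f := fun t : L => F t) (by fun_prop) v]
    rcases hF with hF | hF <;> simp only [hF, h]
  have e3 : sweedler (fun u c => sweedler (fun a b => F (p a * antipode k (p b) * c))
      (comul (R := k) u)) (comul (R := k) x) = F x := by
    simp only [← lm_sweedler, ← sweedler_mul, e1, smul_mul_assoc, one_mul]
    rw [sw_counit_l (f := fun t : L => t) (by fun_prop)]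
  rw [← e3, sw_coassoc (by fun_prop) (by fun_prop) (by fun_prop)]
  rcases hF with hF | hF
  · have : ∀ a v : L, sweedler (fun b c => F (p a * antipode k (p b) * c)) (comul (R := k) v) =
        counit (R := k) v • (F (p a) * F 1) := by
      intro a v
      rw [← mul_smul_comm, ← e2, mul_sweedler]
      simp only [mul_assoc, hF]
    simp only [this]
    rw [sw_counit_r (f := fun a => F (p a) * F 1) (by fun_prop), ← hF, mul_one]
  · have : ∀ a v : L, sweedler (fun b c => F (p a * antipode k (p b) * c)) (comul (R := k) v) =
        counit (R := k) v • (F 1 * F (p a)) := by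
      intro a v
      rw [← smul_mul_assoc, ← e2, sweedler_mul]
      simp only [mul_assoc, hF]
    simp only [this]
    rw [sw_counit_r (f := fun a => F 1 * F (p a)) (by fun_prop), ← hF, mul_one]

theorem comul_antipode_pow (n : ℕ) (x : L) :
    comul (R := k) (((antipode k : L →ₗ[k] L) ^ (2 * n)) x) =
      sweedler (fun a b => ((antipode k : L →ₗ[k] L) ^ (2 * n)) a ⊗ₜ[k]
        ((antipode k : L →ₗ[k] L) ^ (2 * n)) b) (comul (R := k) x) := by
  induction n with
  | zero => exact (sweedler_self _).symm
  | succ n ih =>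
    have : 2 * (n + 1) = 2 * n + 1 + 1 := by ring
    rw [this]
    simp only [pow_succ' _ (2 * n + 1), pow_succ' _ (2 * n), Module.End.mul_apply]
    rw [comul_antipode, sw_antipode (by fun_prop) (by fun_prop), ih]
    simp (disch := fun_prop) only [sweedler_sweedler, sweedler_tmul]

theorem counit_antipode_pow (n : ℕ) (x : L) :
    counit (R := k) (((antipode k : L →ₗ[k] L) ^ n) x) = counit (R := k) x := by
  induction n with
  | zero => rfl
  | succ n ih => simp only [pow_succ', Module.End.mul_apply, counit_antipode, ih]

theorem antipode_bijective [FiniteDimensional k L] :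
    Function.Bijective (antipode k : L →ₗ[k] L) := by
  suffices hinj : Function.Injective (antipode k : L →ₗ[k] L) from
    ⟨hinj, LinearMap.injective_iff_surjective.mp hinj⟩
  obtain ⟨m, hm⟩ := Filter.eventually_atTop.mp
    (LinearMap.eventually_isCompl_ker_pow_range_pow (antipode k : L →ₗ[k] L))
  have hc := hm (2 * (m + 1)) (by omega)
  set G : L →ₗ[k] L := (antipode k : L →ₗ[k] L) ^ (2 * (m + 1)) with hG
  have hker : LinearMap.ker (G ∘ₗ G) ≤ LinearMap.ker G := by
    intro x hx
    have h1 : G x ∈ LinearMap.ker G ⊓ LinearMap.range G := ⟨hx, x, rfl⟩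
    rw [hc.inf_eq_bot] at h1
    exact h1
  have hran : ∀ x, ∃ z, G x = G (G z) := by
    intro x
    have hx : x ∈ LinearMap.ker G ⊔ LinearMap.range G := by rw [hc.sup_eq_top]; trivial
    obtain ⟨a, ha, b, ⟨z, rfl⟩, rfl⟩ := Submodule.mem_sup.mp hx
    exact ⟨z, by rw [map_add, LinearMap.mem_ker.mp ha, zero_add]⟩
  obtain ⟨q, hq⟩ : ∃ q : L →ₗ[k] L, ∀ x, q (G (G x)) = G x := by
    obtain ⟨g, hg⟩ := (G.domRestrict (LinearMap.range G)).exists_leftInverse_of_injective (by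
      rw [LinearMap.ker_eq_bot']
      rintro ⟨_, x, rfl⟩ hx
      exact Subtype.ext (hker (x := x) hx))
    refine ⟨(LinearMap.range G).subtype ∘ₗ g, fun x => ?_⟩
    exact congrArg Subtype.val (LinearMap.congr_fun hg ⟨G x, x, rfl⟩)
  have hp : ∀ x, comul (R := k) ((q ∘ₗ G) x) =
      sweedler (fun a b => (q ∘ₗ G) a ⊗ₜ[k] (q ∘ₗ G) b) (comul (R := k) x) := by
    intro x
    obtain ⟨z, hz⟩ := hran x
    have e : sweedler (fun a b => (q ∘ₗ G) a ⊗ₜ[k] (q ∘ₗ G) b) (comul (R := k) x) =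
        sweedler (fun a b => q a ⊗ₜ[k] q b) (comul (R := k) (G x)) := by
      rw [hG, comul_antipode_pow, ← hG]
      simp (disch := fun_prop) only [sweedler_sweedler, sweedler_tmul, LinearMap.comp_apply]
    rw [e, LinearMap.comp_apply, hz, hq, hG]
    simp only [comul_antipode_pow]
    rw [← hG]
    simp (disch := fun_prop) only [sweedler_sweedler, sweedler_tmul, hq]
  have hε : ∀ x, counit (R := k) ((q ∘ₗ G) x) = counit (R := k) x := by
    intro x
    obtain ⟨z, hz⟩ := hran x
    have h1 : ∀ y, counit (R := k) (G y) = counit (R := k) y := counit_antipode_pow _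
    rw [LinearMap.comp_apply, hz, hq, ← h1 x, hz, h1, h1, h1]
  have hdesc : ∀ j : ℕ, (∀ x, ((antipode k : L →ₗ[k] L) ^ j) ((q ∘ₗ G) x) =
      ((antipode k : L →ₗ[k] L) ^ j) x) → ∀ x, (q ∘ₗ G) x = x := by
    intro j
    induction j with
    | zero => exact fun h => h
    | succ j ih =>
      intro h
      apply ih
      refine antipode_cancel _ _ (antipode_pow_mul j) hp hε ?_
      intro x
      simpa only [pow_succ, Module.End.mul_apply] using h x
  have hid := hdesc (2 * (m + 1)) (by
    intro x
    obtain ⟨z, hz⟩ := hran x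
    rw [← hG, LinearMap.comp_apply, hz, hq])
  intro x y hxy
  have hGxy : G x = G y := by
    have : 2 * (m + 1) = 2 * m + 1 + 1 := by ring
    rw [hG, this, pow_succ, Module.End.mul_apply, hxy, Module.End.mul_apply]
  rw [← hid x, ← hid y, LinearMap.comp_apply, hGxy, LinearMap.comp_apply]

end AntipodeBijective

end Sweedler

/-- The inverse of the antipode of a finite-dimensional Hopf algebra. -/
noncomputable def antipodeInv (k L : Type*) [Field k] [Ring L] [HopfAlgebra k L]
    [FiniteDimensional k L] : L →ₗ[k] L :=
  (LinearEquiv.ofBijective (antipode k : L →ₗ[k] L) Sweedler.antipode_bijective).symm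

theorem antipode_antipodeInv {k L : Type*} [Field k] [Ring L] [HopfAlgebra k L]
    [FiniteDimensional k L] (ℓ : L) : antipode k (antipodeInv k L ℓ) = ℓ :=
  (LinearEquiv.ofBijective (antipode k : L →ₗ[k] L) Sweedler.antipode_bijective).apply_symm_apply ℓ

/-! ### Weak Hopf algebras and their integrals -/

/-- A weak Hopf algebra over the field `k`: a `k`-algebra which is also a `k`-coalgebra, whose
comultiplication is multiplicative (but need not preserve the unit), with the weakened
compatibility axioms and an antipode. -/
class WeakHopfAlgebra (k H : Type*) [Field k] [Ring H] [Algebra k H] extends Coalgebra k H where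
  /-- `Δ(ab) = Δ(a)Δ(b)` -/
  comul_mul' : ∀ a b : H, comul (a * b) = comul a * comul b
  /-- `ε(abc) = ε(ab₁)ε(b₂c)` -/
  counit_mul_left : ∀ a b c : H, counit (a * b * c) =
    sweedler (fun b₁ b₂ => counit (a * b₁) * counit (b₂ * c)) (comul b)
  /-- `ε(abc) = ε(ab₂)ε(b₁c)` -/
  counit_mul_right : ∀ a b c : H, counit (a * b * c) =
    sweedler (fun b₁ b₂ => counit (a * b₂) * counit (b₁ * c)) (comul b)
  /-- `Δ²(1) = (Δ(1) ⊗ 1)(1 ⊗ Δ(1))` -/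
  comul_one_left : comul.lTensor H (comul 1) =
    TensorProduct.assoc k H H H (comul (1 : H) ⊗ₜ[k] (1 : H)) * ((1 : H) ⊗ₜ[k] comul (1 : H))
  /-- `Δ²(1) = (1 ⊗ Δ(1))(Δ(1) ⊗ 1)` -/
  comul_one_right : comul.lTensor H (comul 1) =
    ((1 : H) ⊗ₜ[k] comul (1 : H)) * TensorProduct.assoc k H H H (comul (1 : H) ⊗ₜ[k] (1 : H))
  /-- the antipode -/
  antipode : H →ₗ[k] H
  /-- `S(h₁)h₂ = εₛ(h)`, where `εₛ(h) = 1₁ ε(h1₂)` -/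
  antipode_mul : ∀ h : H, sweedler (fun h₁ h₂ => antipode h₁ * h₂) (comul h) =
    sweedler (fun u v => counit (h * v) • u) (comul (1 : H))
  /-- `h₁S(h₂) = εₜ(h)`, where `εₜ(h) = ε(1₁h) 1₂` -/
  mul_antipode : ∀ h : H, sweedler (fun h₁ h₂ => h₁ * antipode h₂) (comul h) =
    sweedler (fun u v => counit (u * h) • v) (comul (1 : H))
  /-- `S(h₁)h₂S(h₃) = S(h)` -/
  antipode_mul_antipode : ∀ h : H, sweedler (fun h₁ h' => sweedler (fun h₂ h₃ =>
    antipode h₁ * h₂ * antipode h₃) (comul h')) (comul h) = antipode h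

namespace WeakHopfAlgebra

variable {k H : Type*} [Field k] [Ring H] [Algebra k H] [WeakHopfAlgebra k H]

variable (k) in
/-- The target counital map `εₜ(x) = ε(1₁x) 1₂`. -/
noncomputable def targetCounital (x : H) : H :=
  sweedler (fun u v => counit (R := k) (u * x) • v) (comul (R := k) (1 : H))

variable (k) in
/-- `Λ` is a left integral if `hΛ = εₜ(h)Λ` for all `h`. -/
def IsLeftIntegral (Λ : H) : Prop := ∀ h : H, h * Λ = targetCounital k h * Λ

variable (k) in
/-- The map `Ψ_Λ : H* → H`, `φ ↦ Λ₁ φ(Λ₂)`. -/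
noncomputable def integralMap (Λ : H) (φ : Module.Dual k H) : H :=
  sweedler (fun u v => φ v • u) (comul (R := k) Λ)

variable (k) in
/-- An integral `Λ` is non-degenerate if `Ψ_Λ` is a bijection. -/
def IsNondegenerate (Λ : H) : Prop := Function.Bijective (integralMap k Λ)

end WeakHopfAlgebra

/-! ### Quantum transformation groupoids -/

/-- The data from which a quantum transformation groupoid is built: a right `L`-module algebra
structure on `B` and a symmetric separability idempotent `e = e¹ ⊗ e²` of `B` (so that `B` is
strongly separable) which is compatible with the action. -/
structure TransformationDatum (k L B : Type*) [Field k] [Ring L] [HopfAlgebra k L] [Ring B]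
    [Algebra k B] where
  /-- the action `b ◁ ℓ` -/
  act : B →ₗ[k] L →ₗ[k] B
  /-- `(b ◁ ℓ) ◁ ℓ' = b ◁ (ℓℓ')` -/
  act_act : ∀ b ℓ ℓ', act (act b ℓ) ℓ' = act b (ℓ * ℓ')
  /-- `b ◁ 1 = b` -/
  act_one : ∀ b, act b 1 = b
  /-- `(bb') ◁ ℓ = (b ◁ ℓ₁)(b' ◁ ℓ₂)` -/
  mul_act : ∀ b b' ℓ, act (b * b') ℓ =
    sweedler (fun ℓ₁ ℓ₂ => act b ℓ₁ * act b' ℓ₂) (comul (R := k) ℓ)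
  /-- `1 ◁ ℓ = ε(ℓ)1` -/
  one_act : ∀ ℓ, act 1 ℓ = counit (R := k) ℓ • (1 : B)
  /-- the symmetric separability idempotent `e¹ ⊗ e²` -/
  e : B ⊗[k] B
  /-- `be¹ ⊗ e² = e¹ ⊗ e²b` -/
  mul_e : ∀ b, sweedler (fun e₁ e₂ => (b * e₁) ⊗ₜ[k] e₂) e =
    sweedler (fun e₁ e₂ => e₁ ⊗ₜ[k] (e₂ * b)) e
  /-- `e¹e² = 1` -/
  e_mul : sweedler (fun e₁ e₂ => e₁ * e₂) e = 1
  /-- `e¹ ⊗ e² = e² ⊗ e¹` -/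
  e_symm : e = sweedler (fun e₁ e₂ => e₂ ⊗ₜ[k] e₁) e
  /-- `(e¹ ◁ ℓ) ⊗ e² = e¹ ⊗ (e² ◁ S(ℓ))` -/
  act_e : ∀ ℓ, sweedler (fun e₁ e₂ => act e₁ ℓ ⊗ₜ[k] e₂) e =
    sweedler (fun e₁ e₂ => e₁ ⊗ₜ[k] act e₂ (antipode k ℓ)) e

namespace TransformationDatum

open Sweedler

variable {k L B M : Type*} [Field k] [Ring L] [HopfAlgebra k L] [Ring B] [Algebra k B]
  [AddCommGroup M] [Module k M] (D : TransformationDatum k L B)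

theorem sw_e_symm {f : B → B → M} (h1 : ∀ y, IsLinearMap k (fun x => f x y))
    (h2 : ∀ x, IsLinearMap k (fun y => f x y)) :
    sweedler f D.e = sweedler (fun x y => f y x) D.e := by
  conv_lhs => rw [D.e_symm]
  simp (disch := fun_prop) only [sweedler_sweedler, sweedler_tmul]

theorem sw_mul_e {f : B → B → M} (h1 : ∀ y, IsLinearMap k (fun x => f x y))
    (h2 : ∀ x, IsLinearMap k (fun y => f x y))
    (b : B) :
    sweedler (fun x y => f (b * x) y) D.e = sweedler (fun x y => f x (y * b)) D.e := by
  have := congrArg (sweedler f) (D.mul_e b)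
  simpa (disch := fun_prop) only [sweedler_sweedler, sweedler_tmul] using this

theorem sw_e_mul {f : B → B → M} (h1 : ∀ y, IsLinearMap k (fun x => f x y))
    (h2 : ∀ x, IsLinearMap k (fun y => f x y))
    (b : B) :
    sweedler (fun x y => f (x * b) y) D.e = sweedler (fun x y => f x (b * y)) D.e := by
  rw [D.sw_e_symm (by fun_prop) (by fun_prop),
    ← D.sw_mul_e (f := fun x y => f y x) (by fun_prop) (by fun_prop),
    D.sw_e_symm (by fun_prop) (by fun_prop)]

theorem sw_act_e {f : B → B → M} (h1 : ∀ y, IsLinearMap k (fun x => f x y))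
    (h2 : ∀ x, IsLinearMap k (fun y => f x y))
    (ℓ : L) :
    sweedler (fun x y => f (D.act x ℓ) y) D.e =
      sweedler (fun x y => f x (D.act y (antipode k ℓ))) D.e := by
  have := congrArg (sweedler f) (D.act_e ℓ)
  simpa (disch := fun_prop) only [sweedler_sweedler, sweedler_tmul] using this

theorem sw_act_e' {f : B → B → M} (h1 : ∀ y, IsLinearMap k (fun x => f x y))
    (h2 : ∀ x, IsLinearMap k (fun y => f x y))
    (ℓ : L) :
    sweedler (fun x y => f (D.act x (antipode k ℓ)) y) D.e =
      sweedler (fun x y => f x (D.act y ℓ)) D.e := by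
  rw [D.sw_e_symm (by fun_prop) (by fun_prop),
    ← D.sw_act_e (f := fun x y => f y x) (by fun_prop) (by fun_prop),
    D.sw_e_symm (by fun_prop) (by fun_prop)]

theorem sw_e_one {f : B → M} (h : IsLinearMap k f) :
    sweedler (fun x y => f (x * y)) D.e = f 1 := by
  rw [← D.e_mul, map_sweedler h]

theorem sw_mul_act {f : B → M} (h : IsLinearMap k f) (b b' : B) (ℓ : L) :
    f (D.act (b * b') ℓ) =
      sweedler (fun ℓ₁ ℓ₂ => f (D.act b ℓ₁ * D.act b' ℓ₂)) (comul (R := k) ℓ) := by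
  rw [D.mul_act, map_sweedler h]

/-- The trace form `ω` exists and is unique. -/
theorem existsUnique_traceForm [FiniteDimensional k B] :
    ∃! ω : B →ₗ[k] k, sweedler (fun e₁ e₂ => ω e₁ • e₂) D.e = 1 ∧
      sweedler (fun e₁ e₂ => ω e₂ • e₁) D.e = 1 := by
  have ex : ∃ ω : B →ₗ[k] k, sweedler (fun e₁ e₂ => ω e₁ • e₂) D.e = 1 := by
    let b := Module.finBasis k B
    refine ⟨∑ i, b.coord i ∘ₗ LinearMap.mulRight k (b i), ?_⟩
    calc _ = ∑ i, sweedler (fun e₁ e₂ => b.coord i (e₁ * b i) • e₂) D.e := by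
          simp only [sweedler, LinearMap.sum_apply, Finset.sum_smul]
          rw [Finset.sum_comm]; rfl
      _ = ∑ i, sweedler (fun e₁ e₂ => (b.coord i e₁ • b i) * e₂) D.e := by
          refine Finset.sum_congr rfl fun i _ => ?_
          rw [D.sw_e_mul (f := fun x y => b.coord i x • y) (by fun_prop) (by fun_prop)]
          simp only [smul_mul_assoc]
      _ = sweedler (fun e₁ e₂ => e₁ * e₂) D.e := by
          simp only [sweedler]
          rw [Finset.sum_comm]
          refine Finset.sum_congr rfl fun p _ => ?_
          rw [← Finset.sum_mul]
          congr 1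
          exact b.sum_repr p.1
      _ = 1 := D.e_mul
  obtain ⟨ω, hω⟩ := ex
  refine ⟨ω, ⟨hω, ?_⟩, ?_⟩
  · rw [← hω]
    exact D.sw_e_symm (f := fun e₁ e₂ => ω e₂ • e₁) (by fun_prop) (by fun_prop)
  · rintro φ ⟨hφ, -⟩
    ext x
    have hx : sweedler (fun e₁ e₂ => ω (x * e₁) • e₂) D.e = x := by
      rw [D.sw_mul_e (f := fun e₁ e₂ => ω e₁ • e₂) (by fun_prop) (by fun_prop)]
      simp only [← smul_mul_assoc]
      rw [← sweedler_mul, hω, one_mul]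
    calc φ x = sweedler (fun e₁ e₂ => ω (x * e₁) * φ e₂) D.e := by
          conv_lhs => rw [← hx, lm_sweedler]
          simp only [map_smul, smul_eq_mul]
      _ = sweedler (fun e₁ e₂ => ω (x * (φ e₁ • e₂))) D.e := by
          rw [D.sw_e_symm (by fun_prop) (by fun_prop)]
          simp only [mul_smul_comm, map_smul, smul_eq_mul, mul_comm]
      _ = ω x := by
          rw [← map_sweedler (φ := fun t => ω (x * t)) (by fun_prop), hφ, mul_one]

/-- The trace form `ω : B → k`, defined by `ω(e¹)e² = 1 = e¹ω(e²)`. -/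
noncomputable def traceForm [FiniteDimensional k B] : B →ₗ[k] k :=
  D.existsUnique_traceForm.choose

section TraceForm

variable [FiniteDimensional k B]

theorem sw_trace {f : B → M} (h : IsLinearMap k f) :
    sweedler (fun x y => D.traceForm x • f y) D.e = f 1 := by
  rw [← D.existsUnique_traceForm.choose_spec.1.1, map_sweedler h]
  simp only [h.map_smul]
  rfl

theorem sw_trace_mul {f : B → M} (h : IsLinearMap k f) (b : B) :
    sweedler (fun x y => D.traceForm (b * x) • f y) D.e = f b := by
  rw [D.sw_mul_e (f := fun x y => D.traceForm x • f y) (by fun_prop) (by fun_prop),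
    D.sw_trace (f := fun y => f (y * b)) (by fun_prop), one_mul]

theorem sw_trace_mul' {f : B → M} (h : IsLinearMap k f) (b : B) :
    sweedler (fun x y => D.traceForm (x * b) • f y) D.e = f b := by
  rw [D.sw_e_mul (f := fun x y => D.traceForm x • f y) (by fun_prop) (by fun_prop),
    D.sw_trace (f := fun y => f (b * y)) (by fun_prop), mul_one]

/-- Two functionals with the same value on `e` agree. -/
theorem dual_ext {φ ψ : B → M} (hφ : IsLinearMap k φ) (hψ : IsLinearMap k ψ)
    (h : sweedler (fun x y => φ x ⊗ₜ[k] y) D.e = sweedler (fun x y => ψ x ⊗ₜ[k] y) D.e) (b : B) :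
    φ b = ψ b := by
  have key := congrArg (sweedler fun m y => D.traceForm (b * y) • m) h
  simp (disch := fun_prop) only [sweedler_sweedler, sweedler_tmul] at key
  rw [D.sw_e_symm (by fun_prop) (by fun_prop), D.sw_trace_mul hφ,
    D.sw_e_symm (by fun_prop) (by fun_prop), D.sw_trace_mul hψ] at key
  exact key

theorem traceForm_comm (a b : B) : D.traceForm (a * b) = D.traceForm (b * a) := by
  refine D.dual_ext (φ := fun a => D.traceForm (a * b)) (ψ := fun a => D.traceForm (b * a))
    (by fun_prop) (by fun_prop) ?_ a
  rw [D.sw_e_mul (f := fun x y => D.traceForm x ⊗ₜ[k] y) (by fun_prop) (by fun_prop),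
    D.sw_mul_e (f := fun x y => D.traceForm x ⊗ₜ[k] y) (by fun_prop) (by fun_prop)]
  have : ∀ (c : k) (y : B), c ⊗ₜ[k] y = (1 : k) ⊗ₜ[k] (c • y) := by
    intro c y; rw [← TensorProduct.smul_tmul, smul_eq_mul, mul_one]
  simp only [this (D.traceForm _)]
  simp only [TensorProduct.tmul_smul]
  rw [D.sw_trace (f := fun y => (1 : k) ⊗ₜ[k] (b * y)) (by fun_prop),
    D.sw_trace (f := fun y => (1 : k) ⊗ₜ[k] (y * b)) (by fun_prop), one_mul, mul_one]

theorem traceForm_act (b : B) (ℓ : L) :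
    D.traceForm (D.act b ℓ) = counit (R := k) ℓ * D.traceForm b := by
  refine D.dual_ext (φ := fun b => D.traceForm (D.act b ℓ))
    (ψ := fun b => counit (R := k) ℓ * D.traceForm b) (by fun_prop) (by fun_prop) ?_ b
  rw [D.sw_act_e (f := fun x y => D.traceForm x ⊗ₜ[k] y) (by fun_prop) (by fun_prop)]
  have : ∀ (c : k) (y : B), c ⊗ₜ[k] y = c • ((1 : k) ⊗ₜ[k] y) := by
    intro c y; rw [TensorProduct.smul_tmul', smul_eq_mul, mul_one]
  simp only [this (D.traceForm _), this (_ * D.traceForm _), mul_smul]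
  rw [D.sw_trace (f := fun y => (1 : k) ⊗ₜ[k] (D.act y (antipode k ℓ))) (by fun_prop),
    ← smul_sweedler, D.sw_trace (f := fun y => (1 : k) ⊗ₜ[k] y) (by fun_prop), D.one_act,
    counit_antipode, TensorProduct.tmul_smul]

theorem act_antipode_antipode (b : B) (ℓ : L) :
    D.act b (antipode k (antipode k ℓ)) = D.act b ℓ := by
  refine D.dual_ext (φ := fun b => D.act b (antipode k (antipode k ℓ)))
    (ψ := fun b => D.act b ℓ) (by fun_prop) (by fun_prop) ?_ b
  rw [D.sw_act_e' (f := fun x y => x ⊗ₜ[k] y) (by fun_prop) (by fun_prop),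
    D.sw_act_e (f := fun x y => x ⊗ₜ[k] y) (by fun_prop) (by fun_prop)]

theorem traceForm_act_mul (a b : B) (ℓ : L) :
    D.traceForm (D.act a ℓ * b) = D.traceForm (a * D.act b (antipode k ℓ)) := by
  have e1 : ∀ u v : L, counit (R := k) v • D.traceForm (D.act b (antipode k u) * a) =
      sweedler (fun x y => D.traceForm (D.act b (antipode k u * x) * D.act a y))
        (comul (R := k) v) := by
    intro u v
    rw [smul_eq_mul, ← D.traceForm_act, D.mul_act, lm_sweedler]
    simp only [D.act_act]
  rw [D.traceForm_comm a, ← sw_counit_r (k := k) (f := fun u => D.traceForm (D.act b (antipode k u) * a))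
    (by fun_prop) ℓ]
  simp only [e1]
  rw [← sw_coassoc (by fun_prop) (by fun_prop) (by fun_prop)]
  have e2 : ∀ u z : L, sweedler (fun x y => D.traceForm (D.act b (antipode k x * y) * D.act a z))
      (comul (R := k) u) = counit (R := k) u • D.traceForm (b * D.act a z) := by
    intro u z
    rw [sw_antipode_l (f := fun t => D.traceForm (D.act b t * D.act a z)) (by fun_prop), D.act_one]
  simp only [e2]
  rw [sw_counit_l (f := fun z => D.traceForm (b * D.act a z)) (by fun_prop), D.traceForm_comm]

theorem traceForm_mul_act_antipodeInv [FiniteDimensional k L] (a b : B) (ℓ : L) :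
    D.traceForm (a * D.act b (antipodeInv k L ℓ)) = D.traceForm (D.act a ℓ * b) := by
  rw [D.traceForm_act_mul]
  conv_rhs => rw [← antipode_antipodeInv (k := k) ℓ, D.act_antipode_antipode]

end TraceForm

end TransformationDatum

/-- The underlying vector space `Bᵒᵖ ⊗ L ⊗ B` of the quantum transformation groupoid `H(L, B)`. -/
def QTG {k L B : Type*} [Field k] [Ring L] [HopfAlgebra k L] [Ring B] [Algebra k B]
    (_D : TransformationDatum k L B) : Type _ := Bᵐᵒᵖ ⊗[k] (L ⊗[k] B)

namespace QTG

open Sweedler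

variable {k L B M X : Type*} [Field k] [Ring L] [HopfAlgebra k L] [Ring B] [Algebra k B]
  [AddCommGroup M] [Module k M] [AddCommGroup X] [Module k X] (D : TransformationDatum k L B)

noncomputable instance instAddCommGroup : AddCommGroup (QTG D) :=
  inferInstanceAs (AddCommGroup (Bᵐᵒᵖ ⊗[k] (L ⊗[k] B)))

noncomputable instance instModule : Module k (QTG D) :=
  inferInstanceAs (Module k (Bᵐᵒᵖ ⊗[k] (L ⊗[k] B)))

/-- The pure tensor `a ⊗ ℓ ⊗ b` in `H(L, B)`. -/
noncomputable def tm (a : B) (ℓ : L) (b : B) : QTG D :=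
  (MulOpposite.op a ⊗ₜ[k] (ℓ ⊗ₜ[k] b) : Bᵐᵒᵖ ⊗[k] (L ⊗[k] B))

theorem lin_op : IsLinearMap k (fun a : B => MulOpposite.op a) := ⟨fun _ _ => rfl, fun _ _ => rfl⟩

theorem lin_unop : IsLinearMap k (fun a : Bᵐᵒᵖ => a.unop) := ⟨fun _ _ => rfl, fun _ _ => rfl⟩

@[fun_prop] theorem lin_tm₁ {g : X → B} (hg : IsLinearMap k g) (ℓ : L) (b : B) :
    IsLinearMap k (fun x => tm D (g x) ℓ b) :=
  lin_tmul_l (lin_comp lin_op hg) (ℓ ⊗ₜ[k] b)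

@[fun_prop] theorem lin_tm₂ {g : X → L} (hg : IsLinearMap k g) (a b : B) :
    IsLinearMap k (fun x => tm D a (g x) b) :=
  lin_tmul_r (lin_tmul_l hg b) (MulOpposite.op a)

@[fun_prop] theorem lin_tm₃ {g : X → B} (hg : IsLinearMap k g) (a : B) (ℓ : L) :
    IsLinearMap k (fun x => tm D a ℓ (g x)) :=
  lin_tmul_r (lin_tmul_r hg ℓ) (MulOpposite.op a)

/-- The linear map out of `H(L, B)` induced by a trilinear map. -/
noncomputable def lift3 (f : B → L → B → M) (h1 : ∀ ℓ b, IsLinearMap k (fun a => f a ℓ b))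
    (h2 : ∀ a b, IsLinearMap k (fun ℓ => f a ℓ b)) (h3 : ∀ a ℓ, IsLinearMap k (fun b => f a ℓ b)) :
    QTG D →ₗ[k] M :=
  TensorProduct.lift (M := Bᵐᵒᵖ) (N := L ⊗[k] B) (IsLinearMap.mk' (fun a : Bᵐᵒᵖ =>
    IsLinearMap.mk' (fun t : L ⊗[k] B => sweedler (fun ℓ b => f a.unop ℓ b) t) (by fun_prop))
    ⟨fun x y => LinearMap.ext fun t => by
        simp [sweedler, (h1 _ _).map_add, Finset.sum_add_distrib],
      fun c x => LinearMap.ext fun t => by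
        simp [sweedler, (h1 _ _).map_smul, Finset.smul_sum]⟩)

theorem lift3_tm {f : B → L → B → M} (h1 : ∀ ℓ b, IsLinearMap k (fun a => f a ℓ b))
    (h2 : ∀ a b, IsLinearMap k (fun ℓ => f a ℓ b)) (h3 : ∀ a ℓ, IsLinearMap k (fun b => f a ℓ b))
    (a : B) (ℓ : L) (b : B) : lift3 D f h1 h2 h3 (tm D a ℓ b) = f a ℓ b := by
  simp only [lift3, tm]
  erw [TensorProduct.lift.tmul]
  exact sweedler_tmul (h2 a) (h3 a) ℓ b

variable {D} in
theorem induction_tm {P : QTG D → Prop} (h0 : P 0) (h : ∀ a ℓ b, P (tm D a ℓ b))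
    (hadd : ∀ x y, P x → P y → P (x + y)) (x : QTG D) : P x := by
  refine TensorProduct.induction_on (motive := P) x h0 ?_ hadd
  intro a t
  induction t using TensorProduct.induction_on with
  | zero => rw [TensorProduct.tmul_zero]; exact h0
  | tmul ℓ b => exact h a.unop ℓ b
  | add t s ht hs => rw [TensorProduct.tmul_add]; exact hadd _ _ ht hs

variable {D} in
theorem lin_ext {φ ψ : QTG D → M} (hφ : IsLinearMap k φ) (hψ : IsLinearMap k ψ)
    (h : ∀ a ℓ b, φ (tm D a ℓ b) = ψ (tm D a ℓ b)) (x : QTG D) : φ x = ψ x := by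
  induction x using induction_tm with
  | h0 => exact (hφ.mk' φ).map_zero.trans (hψ.mk' ψ).map_zero.symm
  | h a ℓ b => exact h a ℓ b
  | hadd x y hx hy => rw [hφ.map_add, hψ.map_add, hx, hy]

@[fun_prop] theorem lin_lift3 {f : X → B → L → B → M}
    (h0 : ∀ a ℓ b, IsLinearMap k (fun x => f x a ℓ b))
    (h1 : ∀ x ℓ b, IsLinearMap k (fun a => f x a ℓ b))
    (h2 : ∀ x a b, IsLinearMap k (fun ℓ => f x a ℓ b))
    (h3 : ∀ x a ℓ, IsLinearMap k (fun b => f x a ℓ b)) :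
    IsLinearMap k (fun x => lift3 D (f x) (h1 x) (h2 x) (h3 x)) := by
  constructor
  · intro x y
    refine LinearMap.ext (lin_ext (by fun_prop) (by fun_prop) fun a ℓ b => ?_)
    simp only [LinearMap.add_apply, lift3_tm, (h0 _ _ _).map_add]
  · intro c x
    refine LinearMap.ext (lin_ext (by fun_prop) (by fun_prop) fun a ℓ b => ?_)
    simp only [LinearMap.smul_apply, lift3_tm, (h0 _ _ _).map_smul]

/-- The multiplication
`(a ⊗ ℓ ⊗ b)(a' ⊗ ℓ' ⊗ b') = (a' ◁ S(ℓ₁))a ⊗ ℓ₂ℓ'₁ ⊗ (b ◁ ℓ'₂)b'`. -/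
noncomputable def mulMap : QTG D →ₗ[k] QTG D →ₗ[k] QTG D :=
  lift3 D (fun a ℓ b => lift3 D (fun a' ℓ' b' =>
      sweedler (fun ℓ₁ ℓ₂ => sweedler (fun ℓ'₁ ℓ'₂ =>
        tm D (D.act a' (antipode k ℓ₁) * a) (ℓ₂ * ℓ'₁) (D.act b ℓ'₂ * b'))
        (comul (R := k) ℓ')) (comul (R := k) ℓ))
    (by fun_prop) (by fun_prop) (by fun_prop))
  (by fun_prop) (by fun_prop) (by fun_prop)

noncomputable instance : Mul (QTG D) := ⟨fun x y => mulMap D x y⟩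

/-- The unit is `1 ⊗ 1 ⊗ 1`. -/
noncomputable instance : One (QTG D) := ⟨tm D 1 1 1⟩

theorem mul_eq (x y : QTG D) : x * y = mulMap D x y := rfl

theorem one_eq : (1 : QTG D) = tm D 1 1 1 := rfl

theorem tm_mul_tm (a b a' b' : B) (ℓ ℓ' : L) : tm D a ℓ b * tm D a' ℓ' b' =
    sweedler (fun ℓ₁ ℓ₂ => sweedler (fun ℓ'₁ ℓ'₂ =>
      tm D (D.act a' (antipode k ℓ₁) * a) (ℓ₂ * ℓ'₁) (D.act b ℓ'₂ * b'))
      (comul (R := k) ℓ')) (comul (R := k) ℓ) := by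
  rw [mul_eq, mulMap, lift3_tm, lift3_tm]

theorem mulMap_one_left (x : QTG D) : mulMap D 1 x = x := by
  revert x
  refine lin_ext (k := k) (by fun_prop) (by fun_prop) fun a ℓ b => ?_
  rw [← mul_eq, one_eq, tm_mul_tm]
  simp (disch := fun_prop) only [sw_one, antipode_one, D.act_one, D.one_act, one_mul, mul_one,
    smul_mul_assoc]
  have : ∀ x y : L, tm D a x (counit (R := k) y • b) = counit (R := k) y • tm D a x b :=
    fun x y => (lin_tm₃ D lin_id a x).map_smul _ _
  simp only [this]
  exact sw_counit_r (f := fun x => tm D a x b) (by fun_prop) ℓ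

theorem mulMap_one_right (x : QTG D) : mulMap D x 1 = x := by
  revert x
  refine lin_ext (k := k) (by fun_prop) (by fun_prop) fun a ℓ b => ?_
  rw [← mul_eq, one_eq, tm_mul_tm]
  simp (disch := fun_prop) only [sw_one, D.act_one, D.one_act, one_mul, mul_one,
    smul_mul_assoc, counit_antipode]
  have : ∀ x y : L, tm D (counit (R := k) y • a) x b = counit (R := k) y • tm D a x b :=
    fun x y => (lin_tm₁ D lin_id x b).map_smul _ _
  simp only [this]
  exact sw_counit_l (f := fun x => tm D a x b) (by fun_prop) ℓ

theorem tm_sweedler₁ {U V : Type*} [AddCommGroup U] [Module k U] [AddCommGroup V] [Module k V]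
    (f : U → V → B) (t : U ⊗[k] V) (ℓ : L) (b : B) :
    tm D (sweedler f t) ℓ b = sweedler (fun u v => tm D (f u v) ℓ b) t :=
  map_sweedler (lin_tm₁ D lin_id ℓ b) f t

theorem tm_sweedler₃ {U V : Type*} [AddCommGroup U] [Module k U] [AddCommGroup V] [Module k V]
    (f : U → V → B) (t : U ⊗[k] V) (a : B) (ℓ : L) :
    tm D a ℓ (sweedler f t) = sweedler (fun u v => tm D a ℓ (f u v)) t :=
  map_sweedler (lin_tm₃ D lin_id a ℓ) f t

theorem tm_smul₁ (c : k) (a : B) (ℓ : L) (b : B) : tm D (c • a) ℓ b = c • tm D a ℓ b :=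
  (lin_tm₁ D lin_id ℓ b).map_smul _ _

theorem tm_smul₃ (c : k) (a : B) (ℓ : L) (b : B) : tm D a ℓ (c • b) = c • tm D a ℓ b :=
  (lin_tm₃ D lin_id a ℓ).map_smul _ _

theorem sw_tm_left (a c x y : B) (m ℓ : L) :
    sweedler (fun ℓ₁ ℓ₂ => tm D (D.act (x * y) (antipode k ℓ₁) * a) (ℓ₂ * m) c)
      (comul (R := k) ℓ) =
    sweedler (fun ℓ₁ w => sweedler (fun ℓ₂ ℓ₃ => tm D (D.act x (antipode k ℓ₂) *
      (D.act y (antipode k ℓ₁) * a)) (ℓ₃ * m) c) (comul (R := k) w)) (comul (R := k) ℓ) := by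
  rw [← sw_coassoc (by fun_prop) (by fun_prop) (by fun_prop)]
  simp only [D.mul_act]
  simp (disch := fun_prop) only [sw_antipode, sweedler_mul, tm_sweedler₁, mul_assoc]

theorem sw_tm_right (a c x y : B) (m ℓ : L) :
    sweedler (fun ℓ₁ ℓ₂ => tm D a (m * ℓ₁) (D.act (x * y) ℓ₂ * c)) (comul (R := k) ℓ) =
    sweedler (fun ℓ₁ w => sweedler (fun ℓ₂ ℓ₃ => tm D a (m * ℓ₁) (D.act x ℓ₂ *
      (D.act y ℓ₃ * c))) (comul (R := k) w)) (comul (R := k) ℓ) := by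
  simp only [D.mul_act, sweedler_mul, tm_sweedler₃, mul_assoc]

theorem sw_block_comm {U V : Type*} [AddCommGroup U] [Module k U] [AddCommGroup V] [Module k V]
    (F : U → V → L → L → L → M) (t : U ⊗[k] V) (ℓ : L) :
    sweedler (fun a b => sweedler (fun c d => sweedler (fun e f => F a b c e f)
      (comul (R := k) d)) (comul (R := k) ℓ)) t =
    sweedler (fun c d => sweedler (fun e f => sweedler (fun a b => F a b c e f) t)
      (comul (R := k) d)) (comul (R := k) ℓ) := by
  rw [sweedler_comm]
  congr 1; funext c d
  rw [sweedler_comm]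

theorem mulMap_assoc (x y z : QTG D) :
    mulMap D (mulMap D x y) z = mulMap D x (mulMap D y z) := by
  revert x
  refine lin_ext (k := k) (by fun_prop) (by fun_prop) fun a ℓ b => ?_
  revert y
  refine lin_ext (k := k) (by fun_prop) (by fun_prop) fun a' ℓ' b' => ?_
  revert z
  refine lin_ext (k := k) (by fun_prop) (by fun_prop) fun a'' ℓ'' b'' => ?_
  simp only [← mul_eq, tm_mul_tm]
  simp only [mul_eq, lm_sweedler, app_sweedler]
  simp only [← mul_eq, tm_mul_tm]
  simp (disch := fun_prop) only [sw_mul, antipode_mul_antidistrib, ← D.act_act]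
  have hL : ∀ f s, _ := fun f s => sweedler_comm (U := L) (V := L) (U' := L) (V' := L)
    (M := QTG D) f (comul (R := k) ℓ') s
  conv_lhs =>
    simp only [hL, sw_tm_right]
    simp (disch := fun_prop) only [sw_coassoc]
  have hR : ∀ f s, _ := fun f s => sweedler_comm (U := L) (V := L) (U' := L) (V' := L)
    (M := QTG D) f (comul (R := k) ℓ) s
  have hR' : ∀ f s, _ := fun f s => sweedler_comm (U := L) (V := L) (U' := L) (V' := L)
    (M := QTG D) f (comul (R := k) ℓ'') s
  conv_rhs =>
    simp only [hR, sw_tm_left]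
    simp only [hR']
    simp (disch := fun_prop) only [sw_coassoc]
    simp only [sw_block_comm _ _ ℓ]
  simp only [mul_assoc]

noncomputable instance instRing : Ring (QTG D) :=
  { instAddCommGroup D with
    mul := fun x y => mulMap D x y
    one := tm D 1 1 1
    left_distrib := fun x y z => (mulMap D x).map_add y z
    right_distrib := fun x y z => LinearMap.congr_fun ((mulMap D).map_add x y) z
    zero_mul := fun x => LinearMap.congr_fun (mulMap D).map_zero x
    mul_zero := fun x => (mulMap D x).map_zero
    mul_assoc := mulMap_assoc D
    one_mul := mulMap_one_left D
    mul_one := mulMap_one_right D }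

noncomputable instance instAlgebra : Algebra k (QTG D) :=
  Algebra.ofModule
    (fun c x y => LinearMap.congr_fun ((mulMap D).map_smul c x) y)
    (fun c x y => (mulMap D x).map_smul c y)

end QTG

namespace QTG

open Sweedler

variable {k L B M X : Type*} [Field k] [Ring L] [HopfAlgebra k L] [Ring B] [Algebra k B]
  [AddCommGroup M] [Module k M] [AddCommGroup X] [Module k X] (D : TransformationDatum k L B)

/-- The comultiplication
`Δ(a ⊗ ℓ ⊗ b) = (a ⊗ ℓ₁ ⊗ e¹) ⊗ ((e² ◁ S(ℓ₂)) ⊗ ℓ₃ ⊗ b)`. -/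
noncomputable def comulMap : QTG D →ₗ[k] QTG D ⊗[k] QTG D :=
  lift3 D (fun a ℓ b => sweedler (fun ℓ₁ w => sweedler (fun ℓ₂ ℓ₃ => sweedler (fun e₁ e₂ =>
      tm D a ℓ₁ e₁ ⊗ₜ[k] tm D (D.act e₂ (antipode k ℓ₂)) ℓ₃ b)
      D.e) (comul (R := k) w)) (comul (R := k) ℓ))
    (by fun_prop) (by fun_prop) (by fun_prop)

/-- The counit `ε(a ⊗ ℓ ⊗ b) = ω(a(b ◁ S⁻¹(ℓ)))`. -/
noncomputable def counitMap [FiniteDimensional k L] [FiniteDimensional k B] : QTG D →ₗ[k] k :=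
  lift3 D (fun a ℓ b => D.traceForm (a * D.act b (antipodeInv k L ℓ)))
    (by fun_prop) (by fun_prop) (by fun_prop)

/-- The antipode `S(a ⊗ ℓ ⊗ b) = b ⊗ S(ℓ) ⊗ a`. -/
noncomputable def antipodeMap : QTG D →ₗ[k] QTG D :=
  lift3 D (fun a ℓ b => tm D b (antipode k ℓ) a) (by fun_prop) (by fun_prop) (by fun_prop)

theorem comulMap_tm (a b : B) (ℓ : L) : comulMap D (tm D a ℓ b) =
    sweedler (fun ℓ₁ w => sweedler (fun ℓ₂ ℓ₃ => sweedler (fun e₁ e₂ =>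
      tm D a ℓ₁ e₁ ⊗ₜ[k] tm D (D.act e₂ (antipode k ℓ₂)) ℓ₃ b)
      D.e) (comul (R := k) w)) (comul (R := k) ℓ) := by
  rw [comulMap, lift3_tm]

theorem counitMap_tm [FiniteDimensional k L] [FiniteDimensional k B] (a b : B) (ℓ : L) :
    counitMap D (tm D a ℓ b) = D.traceForm (a * D.act b (antipodeInv k L ℓ)) := by
  rw [counitMap, lift3_tm]

theorem counitMap_tm' [FiniteDimensional k L] [FiniteDimensional k B] (a b : B) (ℓ : L) :
    counitMap D (tm D a ℓ b) = D.traceForm (D.act a ℓ * b) := by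
  rw [counitMap_tm, D.traceForm_mul_act_antipodeInv]

theorem antipodeMap_tm (a b : B) (ℓ : L) :
    antipodeMap D (tm D a ℓ b) = tm D b (antipode k ℓ) a := by
  rw [antipodeMap, lift3_tm]

theorem comulMap_coassoc (x : QTG D) :
    TensorProduct.assoc k (QTG D) (QTG D) (QTG D) ((comulMap D).rTensor (QTG D) (comulMap D x)) =
      (comulMap D).lTensor (QTG D) (comulMap D x) := by
  revert x
  refine lin_ext (k := k) ?_ (by fun_prop) fun a ℓ b => ?_
  · exact ((TensorProduct.assoc k (QTG D) (QTG D) (QTG D)).toLinearMap ∘ₗ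
      (comulMap D).rTensor (QTG D) ∘ₗ comulMap D).isLinear
  simp only [comulMap_tm, lm_sweedler, le_sweedler, LinearMap.rTensor_tmul, LinearMap.lTensor_tmul,
    sweedler_tmul', tmul_sweedler, TensorProduct.assoc_tmul]
  have hE : ∀ (f : B → B → L → L → QTG D ⊗[k] (QTG D ⊗[k] QTG D)) s, _ :=
    fun f s => sweedler_comm f D.e s
  simp only [hE]
  conv_lhs =>
    enter [1, u, v]
    rw [sw_block_comm]
  simp (disch := fun_prop) only [sw_coassoc]
  conv_lhs =>
    enter [1, u, v, 1, u, v, 1, u, v, 1, u, v]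
    rw [sweedler_comm]

/-- Counit axioms. -/
theorem counitMap_left [FiniteDimensional k L] [FiniteDimensional k B] (x : QTG D) :
    sweedler (fun u v => counitMap D u • v) (comulMap D x) = x := by
  revert x
  refine lin_ext (k := k) (by fun_prop) (by fun_prop) fun a ℓ b => ?_
  simp (disch := fun_prop) only [comulMap_tm, sweedler_sweedler, sweedler_tmul, counitMap_tm']
  have h1 : ∀ x y z : L, sweedler (fun e₁ e₂ => D.traceForm (D.act a x * e₁) •
      tm D (D.act e₂ (antipode k y)) z b) D.e = tm D (D.act a (x * antipode k y)) z b := by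
    intro x y z
    rw [D.sw_trace_mul (f := fun t => tm D (D.act t (antipode k y)) z b) (by fun_prop), D.act_act]
  simp only [h1]
  rw [← sw_coassoc (by fun_prop) (by fun_prop) (by fun_prop)]
  have h2 : ∀ u z : L, sweedler (fun x y => tm D (D.act a (x * antipode k y)) z b)
      (comul (R := k) u) = counit (R := k) u • tm D a z b := by
    intro u z
    rw [sw_antipode_r (f := fun t => tm D (D.act a t) z b) (by fun_prop), D.act_one]
  simp only [h2]
  rw [sw_counit_l (f := fun z => tm D a z b) (by fun_prop)]

theorem counitMap_right [FiniteDimensional k L] [FiniteDimensional k B] (x : QTG D) :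
    sweedler (fun u v => counitMap D v • u) (comulMap D x) = x := by
  revert x
  refine lin_ext (k := k) (by fun_prop) (by fun_prop) fun a ℓ b => ?_
  simp (disch := fun_prop) only [comulMap_tm, sweedler_sweedler, sweedler_tmul, counitMap_tm']
  simp only [D.act_act]
  have h1 : ∀ x w : L, sweedler (fun y z => sweedler (fun e₁ e₂ =>
      D.traceForm (D.act e₂ (antipode k y * z) * b) • tm D a x e₁) D.e) (comul (R := k) w) =
      counit (R := k) w • tm D a x b := by
    intro x w
    rw [sw_antipode_l (f := fun t => sweedler (fun e₁ e₂ =>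
      D.traceForm (D.act e₂ t * b) • tm D a x e₁) D.e) (by fun_prop)]
    simp only [D.act_one]
    rw [D.sw_e_symm (by fun_prop) (by fun_prop), D.sw_trace_mul' (by fun_prop)]
  simp only [h1]
  rw [sw_counit_r (f := fun z => tm D a z b) (by fun_prop)]

/-! Multiplicativity of the comultiplication. -/

theorem tm_mul_tm_left (a a' c : B) (ℓ m : L) : tm D a ℓ 1 * tm D a' m c =
    sweedler (fun ℓ₁ ℓ₂ => tm D (D.act a' (antipode k ℓ₁) * a) (ℓ₂ * m) c)
      (comul (R := k) ℓ) := by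
  rw [tm_mul_tm]
  simp only [D.one_act, smul_mul_assoc, one_mul, tm_smul₃]
  congr 1; funext x y
  rw [sw_counit_r (f := fun z => tm D (D.act a' (antipode k x) * a) (y * z) c) (by fun_prop)]

theorem tm_mul_tm_right (a b c : B) (ℓ m : L) : tm D a ℓ b * tm D 1 m c =
    sweedler (fun m₁ m₂ => tm D a (ℓ * m₁) (D.act b m₂ * c)) (comul (R := k) m) := by
  rw [tm_mul_tm]
  simp only [D.one_act, smul_mul_assoc, one_mul, tm_smul₁, counit_antipode]
  simp only [← smul_sweedler]
  rw [sw_counit_l (f := fun y => sweedler (fun m₁ m₂ => tm D a (y * m₁) (D.act b m₂ * c))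
    (comul (R := k) m)) (by fun_prop)]

theorem tm_mul_tm_one (a b c : B) (ℓ : L) : tm D a ℓ b * tm D c 1 1 =
    sweedler (fun ℓ₁ ℓ₂ => tm D (D.act c (antipode k ℓ₁) * a) ℓ₂ b) (comul (R := k) ℓ) := by
  rw [tm_mul_tm]
  simp (disch := fun_prop) only [sw_one, D.act_one, mul_one]

theorem tm_one_mul_tm (a b c : B) (m : L) : tm D 1 1 b * tm D a m c =
    sweedler (fun m₁ m₂ => tm D a m₁ (D.act b m₂ * c)) (comul (R := k) m) := by
  rw [tm_mul_tm]
  simp (disch := fun_prop) only [sw_one, D.act_one, mul_one, one_mul, antipode_one]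

theorem tm_op_mul_tm (a b c : B) (m : L) : tm D c 1 1 * tm D a m b = tm D (a * c) m b := by
  rw [tm_mul_tm_left]
  simp (disch := fun_prop) only [sw_one, D.act_one, one_mul, antipode_one]

theorem comulMap_one : comulMap D 1 =
    sweedler (fun e₁ e₂ => tm D 1 1 e₁ ⊗ₜ[k] tm D e₂ 1 1) D.e := by
  rw [one_eq, comulMap_tm]
  simp (disch := fun_prop) only [sw_one, D.act_one, antipode_one]

/-- `Δ(a ⊗ ℓ ⊗ b) = ((a ⊗ ℓ₁ ⊗ 1) ⊗ (1 ⊗ ℓ₂ ⊗ b)) Δ(1)`. -/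
theorem comulMap_eq (a b : B) (ℓ : L) : comulMap D (tm D a ℓ b) =
    sweedler (fun ℓ₁ ℓ₂ => tm D a ℓ₁ 1 ⊗ₜ[k] tm D 1 ℓ₂ b) (comul (R := k) ℓ) * comulMap D 1 := by
  rw [comulMap_tm, comulMap_one, sweedler_mul]
  congr 1; funext ℓ₁ w
  rw [sweedler_comm, mul_sweedler]
  congr 1; funext e₁ e₂
  rw [Algebra.TensorProduct.tmul_mul_tmul, tm_mul_tm_one, tmul_sweedler, tm_mul_tm_right]
  simp (disch := fun_prop) only [sw_one, D.act_one, one_mul, mul_one]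

theorem sw_act_mul_act (F : B → M) (hF : IsLinearMap k F) (b c : B) (t : L) :
    sweedler (fun x y => F (D.act (b * D.act c x) (antipode k y))) (comul (R := k) t) =
      F (D.act b (antipode k t) * c) := by
  simp (disch := fun_prop) only [D.mul_act, sw_antipode, map_sweedler hF, D.act_act]
  rw [← sw_coassoc (by fun_prop) (by fun_prop) (by fun_prop)]
  have : ∀ u z : L, sweedler (fun x y => F (D.act b (antipode k z) * D.act c (x * antipode k y)))
      (comul (R := k) u) = counit (R := k) u • F (D.act b (antipode k z) * c) := by
    intro u z
    rw [sw_antipode_r (f := fun t => F (D.act b (antipode k z) * D.act c t)) (by fun_prop),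
      D.act_one]
  simp only [this]
  rw [sw_counit_l (f := fun z => F (D.act b (antipode k z) * c)) (by fun_prop)]

/-- `Δ(1)Δ(y) = Δ(y)`. -/
theorem comulMap_one_mul (y : QTG D) : comulMap D 1 * comulMap D y = comulMap D y := by
  revert y
  refine lin_ext (k := k) (by fun_prop) (by fun_prop) fun a ℓ b => ?_
  rw [comulMap_one, comulMap_tm]
  simp only [sweedler_mul, mul_sweedler, Algebra.TensorProduct.tmul_mul_tmul, tm_one_mul_tm,
    tm_op_mul_tm, sweedler_tmul']
  have hE : ∀ (f : B → B → L → L → QTG D ⊗[k] QTG D) s, _ :=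
    fun f s => sweedler_comm f D.e s
  simp only [hE]
  conv_lhs =>
    enter [1, u, v]
    rw [sweedler_comm]
  simp (disch := fun_prop) only [sw_coassoc]
  congr 1; funext m₁ v
  rw [← sw_coassoc (by fun_prop) (by fun_prop) (by fun_prop)]
  congr 1; funext t z
  have h1 : ∀ x y e₁ e₂, sweedler (fun f₁ f₂ => tm D a m₁ (D.act e₁ x * f₁) ⊗ₜ[k]
      tm D (D.act f₂ (antipode k y) * e₂) z b) D.e =
      sweedler (fun f₁ f₂ => tm D a m₁ f₁ ⊗ₜ[k]
        tm D (D.act (f₂ * D.act e₁ x) (antipode k y) * e₂) z b) D.e := by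
    intro x y e₁ e₂
    exact D.sw_mul_e (f := fun f₁ f₂ => tm D a m₁ f₁ ⊗ₜ[k]
        tm D (D.act f₂ (antipode k y) * e₂) z b) (by fun_prop) (by fun_prop) (D.act e₁ x)
  have h2 : ∀ f₁ f₂ e₁ e₂, sweedler (fun x y => tm D a m₁ f₁ ⊗ₜ[k]
        tm D (D.act (f₂ * D.act e₁ x) (antipode k y) * e₂) z b) (comul (R := k) t) =
      tm D a m₁ f₁ ⊗ₜ[k] tm D (D.act f₂ (antipode k t) * e₁ * e₂) z b := by
    intro f₁ f₂ e₁ e₂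
    exact sw_act_mul_act D (fun s => tm D a m₁ f₁ ⊗ₜ[k] tm D (s * e₂) z b) (by fun_prop) f₂ e₁ t
  have hE' : ∀ (f : L → L → B → B → QTG D ⊗[k] QTG D) s, _ :=
    fun f s => sweedler_comm f s D.e
  have h3 : ∀ f₁ f₂, sweedler (fun e₁ e₂ => tm D a m₁ f₁ ⊗ₜ[k]
        tm D (D.act f₂ (antipode k t) * e₁ * e₂) z b) D.e =
      tm D a m₁ f₁ ⊗ₜ[k] tm D (D.act f₂ (antipode k t)) z b := by
    intro f₁ f₂
    simp only [mul_assoc]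
    rw [D.sw_e_one (f := fun s => tm D a m₁ f₁ ⊗ₜ[k]
      tm D (D.act f₂ (antipode k t) * s) z b) (by fun_prop), mul_one]
  conv_lhs =>
    enter [1, x, y]
    rw [sweedler_comm]
  simp only [h1, hE', h2]
  rw [sweedler_comm]
  simp only [h3]

theorem comulMap_mul (x y : QTG D) : comulMap D (x * y) = comulMap D x * comulMap D y := by
  revert x
  refine lin_ext (k := k) (by fun_prop) (by fun_prop) fun a ℓ b => ?_
  rw [comulMap_eq, mul_assoc, comulMap_one_mul]
  revert y
  refine lin_ext (k := k) (by fun_prop) (by fun_prop) fun a' m b' => ?_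
  rw [tm_mul_tm]
  simp only [lm_sweedler, comulMap_tm]
  simp (disch := fun_prop) only [sw_mul]
  simp only [sweedler_mul, mul_sweedler, Algebra.TensorProduct.tmul_mul_tmul, tm_mul_tm_left]
  simp only [tm_mul_tm, sweedler_tmul', tmul_sweedler]
  have hE : ∀ (f : B → B → L → L → QTG D ⊗[k] QTG D) s, _ :=
    fun f s => sweedler_comm f D.e s
  simp only [hE]
  have hL : ∀ (t : L) (f : L → L → L → L → QTG D ⊗[k] QTG D) s, _ :=
    fun t f s => sweedler_comm f s (comul (R := k) t)
  conv_lhs =>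
    enter [1, ℓ₁, u]
    rw [sweedler_comm]
    enter [1, u₁, u₂]
    simp only [hL u₂]
  conv_rhs =>
    simp only [hL ℓ]
    enter [1, ℓ₁, ℓ₂]
    simp only [hL ℓ₂]
    simp only [hL ℓ₁]
  simp (disch := fun_prop) only [sw_coassoc]
  simp only [mul_one, antipode_mul_antidistrib, D.act_act]

end QTG

namespace QTG

open Sweedler

variable {k L B M X : Type*} [Field k] [Ring L] [HopfAlgebra k L] [Ring B] [Algebra k B]
  [AddCommGroup M] [Module k M] [AddCommGroup X] [Module k X] (D : TransformationDatum k L B)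

/-! The weak Hopf algebra structure. -/

/-- The right action of `H(L, B)` on `B`, `c · (a ⊗ ℓ ⊗ b) = ((ac) ◁ ℓ)b`. -/
noncomputable def actB : QTG D →ₗ[k] B →ₗ[k] B :=
  lift3 D (fun a ℓ b => IsLinearMap.mk' (fun c => D.act (a * c) ℓ * b) (by fun_prop))
    (fun ℓ b => ⟨fun x y => by ext c; simp [add_mul], fun t x => by ext c; simp⟩)
    (fun a b => ⟨fun x y => by ext c; simp [add_mul], fun t x => by ext c; simp⟩)
    (fun a ℓ => ⟨fun x y => by ext c; simp [mul_add], fun t x => by ext c; simp⟩)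

theorem actB_tm (a b c : B) (ℓ : L) : actB D (tm D a ℓ b) c = D.act (a * c) ℓ * b := by
  rw [actB, lift3_tm]; rfl

theorem sw_act_act {F : B → M} (hF : IsLinearMap k F) (b c : B) (ℓ : L) :
    sweedler (fun x y => F (D.act (D.act b (antipode k x) * c) y)) (comul (R := k) ℓ) =
      F (b * D.act c ℓ) := by
  simp (disch := fun_prop) only [D.mul_act, map_sweedler hF, D.act_act]
  rw [← sw_coassoc (by fun_prop) (by fun_prop) (by fun_prop)]
  have : ∀ u z : L, sweedler (fun x y => F (D.act b (antipode k x * y) * D.act c z))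
      (comul (R := k) u) = counit (R := k) u • F (b * D.act c z) := by
    intro u z
    rw [sw_antipode_l (f := fun t => F (D.act b t * D.act c z)) (by fun_prop), D.act_one]
  simp only [this]
  rw [sw_counit_l (f := fun z => F (b * D.act c z)) (by fun_prop)]

theorem sw_act_antipode_mul {F : B → M} (hF : IsLinearMap k F) (b c : B) (ℓ : L) :
    sweedler (fun x y => F (D.act b (antipode k y) * D.act c (antipode k x)))
      (comul (R := k) ℓ) = F (D.act (b * c) (antipode k ℓ)) := by
  simp (disch := fun_prop) only [D.mul_act, map_sweedler hF, sw_antipode]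

theorem actB_mul (x y : QTG D) (c : B) : actB D (x * y) c = actB D y (actB D x c) := by
  revert x
  refine lin_ext (k := k) (by fun_prop) (by fun_prop) fun a ℓ b => ?_
  revert y
  refine lin_ext (k := k) (by fun_prop) (by fun_prop) fun a' m b' => ?_
  rw [tm_mul_tm, lm_sweedler, app_sweedler]
  simp only [lm_sweedler, app_sweedler, actB_tm]
  rw [sweedler_comm]
  simp only [mul_assoc, ← D.act_act]
  have h : ∀ m₁ m₂ : L, sweedler (fun ℓ₁ ℓ₂ => D.act (D.act (D.act a' (antipode k ℓ₁) * (a * c)) ℓ₂)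
      m₁ * (D.act b m₂ * b')) (comul (R := k) ℓ) =
      D.act (a' * D.act (a * c) ℓ) m₁ * (D.act b m₂ * b') := fun m₁ m₂ =>
    sw_act_act D (F := fun t => D.act t m₁ * (D.act b m₂ * b')) (by fun_prop) a' (a * c) ℓ
  simp only [h]
  rw [← mul_assoc a', D.mul_act (a' * D.act (a * c) ℓ), sweedler_mul]
  simp only [mul_assoc]

variable [FiniteDimensional k L] [FiniteDimensional k B]

theorem counitMap_eq (x : QTG D) : counitMap D x = D.traceForm (actB D x 1) := by
  revert x
  refine lin_ext (k := k) (by fun_prop) (by fun_prop) fun a ℓ b => ?_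
  rw [counitMap_tm', actB_tm, mul_one]

noncomputable instance instCoalgebra : Coalgebra k (QTG D) where
  comul := comulMap D
  counit := counitMap D
  coassoc := LinearMap.ext (comulMap_coassoc D)
  rTensor_counit_comp_comul := by
    ext x
    conv_lhs => rw [LinearMap.comp_apply, ← sweedler_self (comulMap D x), lm_sweedler]
    conv_rhs => rw [← counitMap_left D x, lm_sweedler]
    congr 1; funext u v
    simp [TensorProduct.smul_tmul']
  lTensor_counit_comp_comul := by
    ext x
    conv_lhs => rw [LinearMap.comp_apply, ← sweedler_self (comulMap D x), lm_sweedler]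
    conv_rhs => rw [← counitMap_right D x, lm_sweedler]
    congr 1; funext u v
    rw [LinearMap.lTensor_tmul, LinearMap.flip_apply, TensorProduct.mk_apply,
      TensorProduct.smul_tmul, smul_eq_mul, mul_one]

theorem comul_eq (x : QTG D) : comul (R := k) x = comulMap D x := rfl

theorem counit_eq (x : QTG D) : counit (R := k) x = counitMap D x := rfl

theorem counitMap_mul_left (x y z : QTG D) : counitMap D (x * y * z) =
    sweedler (fun u v => counitMap D (x * u) * counitMap D (v * z)) (comulMap D y) := by
  simp only [counitMap_eq, actB_mul]
  generalize actB D x 1 = c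
  revert y
  refine lin_ext (k := k) (by fun_prop) (by fun_prop) fun a ℓ b => ?_
  simp (disch := fun_prop) only [comulMap_tm, sweedler_sweedler, sweedler_tmul, actB_tm]
  simp only [mul_one, D.act_act]
  have h : ∀ x w : L, sweedler (fun y z' => sweedler (fun e₁ e₂ =>
      D.traceForm (D.act (a * c) x * e₁) * D.traceForm (actB D z (D.act e₂ (antipode k y * z') * b)))
      D.e) (comul (R := k) w) = counit (R := k) w •
        D.traceForm (actB D z (D.act (a * c) x * b)) := by
    intro x w
    rw [sw_antipode_l (f := fun t => sweedler (fun e₁ e₂ =>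
      D.traceForm (D.act (a * c) x * e₁) * D.traceForm (actB D z (D.act e₂ t * b))) D.e)
      (by fun_prop)]
    simp only [D.act_one, ← smul_eq_mul (D.traceForm _)]
    rw [D.sw_trace_mul (f := fun t => D.traceForm (actB D z (t * b))) (by fun_prop)]
  simp only [h]
  rw [sw_counit_r (f := fun x => D.traceForm (actB D z (D.act (a * c) x * b))) (by fun_prop)]

theorem counitMap_mul_right (x y z : QTG D) : counitMap D (x * y * z) =
    sweedler (fun u v => counitMap D (x * v) * counitMap D (u * z)) (comulMap D y) := by
  simp only [counitMap_eq, actB_mul]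
  generalize actB D x 1 = c
  revert y
  refine lin_ext (k := k) (by fun_prop) (by fun_prop) fun a ℓ b => ?_
  simp (disch := fun_prop) only [comulMap_tm, sweedler_sweedler, sweedler_tmul, actB_tm]
  simp only [mul_one]
  have hE : ∀ (f : L → L → B → B → k) s, _ := fun f s => sweedler_comm f s D.e
  simp only [hE]
  have h : ∀ (e₁ e₂ : B) (x w : L), sweedler (fun y z' =>
      D.traceForm (D.act (D.act e₂ (antipode k y) * c) z' * b) *
        D.traceForm (actB D z (D.act a x * e₁))) (comul (R := k) w) =
      D.traceForm (e₂ * D.act c w * b) * D.traceForm (actB D z (D.act a x * e₁)) :=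
    fun e₁ e₂ x w => sw_act_act D (F := fun t => D.traceForm (t * b) *
      D.traceForm (actB D z (D.act a x * e₁))) (by fun_prop) e₂ c w
  have h' : ∀ x w : L, sweedler (fun e₁ e₂ => D.traceForm (e₂ * D.act c w * b) *
      D.traceForm (actB D z (D.act a x * e₁))) D.e =
      D.traceForm (actB D z (D.act a x * (D.act c w * b))) := by
    intro x w
    rw [D.sw_e_symm (by fun_prop) (by fun_prop)]
    simp only [mul_assoc, ← smul_eq_mul (D.traceForm _)]
    rw [D.sw_trace_mul' (f := fun t => D.traceForm (actB D z (D.act a x * t))) (by fun_prop)]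
  have hE' : ∀ (f : B → B → L → L → k) s, _ := fun f s => sweedler_comm f D.e s
  conv_rhs => simp only [h, hE', h']
  simp only [D.mul_act, sweedler_mul, lm_sweedler, mul_assoc]

theorem sweedler_mul_sweedler {A : Type*} [Ring A] [Algebra k A]
    (f g : B → B → A ⊗[k] (A ⊗[k] A)) (s t : B ⊗[k] B) :
    sweedler f s * sweedler g t =
      sweedler (fun a b => sweedler (fun c d => f a b * g c d) t) s := by
  simp only [← mul_sweedler, ← sweedler_mul]

theorem comulMap_one_left : (comulMap D).lTensor (QTG D) (comulMap D 1) =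
    TensorProduct.assoc k (QTG D) (QTG D) (QTG D) (comulMap D 1 ⊗ₜ[k] (1 : QTG D)) *
      ((1 : QTG D) ⊗ₜ[k] comulMap D 1) := by
  rw [comulMap_one]
  simp only [lm_sweedler, sweedler_tmul', tmul_sweedler, le_sweedler, LinearMap.lTensor_tmul,
    TensorProduct.assoc_tmul, sweedler_mul_sweedler]
  simp (disch := fun_prop) only [comulMap_tm, sw_one, antipode_one, D.act_one, tmul_sweedler]
  simp only [Algebra.TensorProduct.tmul_mul_tmul, mul_one, one_mul, tm_op_mul_tm]

theorem comulMap_one_right : (comulMap D).lTensor (QTG D) (comulMap D 1) =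
    ((1 : QTG D) ⊗ₜ[k] comulMap D 1) *
    TensorProduct.assoc k (QTG D) (QTG D) (QTG D) (comulMap D 1 ⊗ₜ[k] (1 : QTG D)) := by
  rw [comulMap_one]
  simp only [lm_sweedler, sweedler_tmul', tmul_sweedler, le_sweedler, LinearMap.lTensor_tmul,
    TensorProduct.assoc_tmul, sweedler_mul_sweedler]
  simp (disch := fun_prop) only [comulMap_tm, sw_one, antipode_one, D.act_one, tmul_sweedler,
    Algebra.TensorProduct.tmul_mul_tmul, mul_one, one_mul, tm_one_mul_tm]
  rw [sweedler_comm]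

/-- `εₛ(a ⊗ ℓ ⊗ b) = 1 ⊗ 1 ⊗ (a ◁ ℓ)b`. -/
theorem source_tm (a b : B) (ℓ : L) :
    sweedler (fun u v => counitMap D (tm D a ℓ b * v) • u) (comulMap D 1) =
      tm D 1 1 (D.act a ℓ * b) := by
  simp only [counitMap_eq, actB_mul]
  rw [comulMap_one]
  simp (disch := fun_prop) only [sweedler_sweedler, sweedler_tmul, actB_tm, D.act_one, mul_one]
  rw [D.sw_e_symm (by fun_prop) (by fun_prop), D.sw_trace_mul' (by fun_prop)]

/-- `εₜ(a ⊗ ℓ ⊗ b) = (b ◁ S(ℓ))a ⊗ 1 ⊗ 1`. -/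
theorem target_tm (a b : B) (ℓ : L) :
    sweedler (fun u v => counitMap D (u * tm D a ℓ b) • v) (comulMap D 1) =
      tm D (D.act b (antipode k ℓ) * a) 1 1 := by
  simp only [counitMap_eq, actB_mul]
  rw [comulMap_one]
  simp (disch := fun_prop) only [sweedler_sweedler, sweedler_tmul, actB_tm, D.act_one, mul_one,
    one_mul]
  simp only [D.traceForm_act_mul, D.traceForm_comm _ (D.act b (antipode k ℓ)), ← mul_assoc]
  rw [D.sw_trace_mul (f := fun t => tm D t 1 1) (by fun_prop)]

theorem antipodeMap_mul (x : QTG D) :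
    sweedler (fun u v => antipodeMap D u * v) (comulMap D x) =
      sweedler (fun u v => counitMap D (x * v) • u) (comulMap D 1) := by
  revert x
  refine lin_ext (k := k) (by fun_prop) (by fun_prop) fun a ℓ b => ?_
  rw [source_tm]
  simp (disch := fun_prop) only [comulMap_tm, sweedler_sweedler, sweedler_tmul, antipodeMap_tm,
    tm_mul_tm, sw_antipode]
  have hE : ∀ (f : B → B → L → L → QTG D) s, _ := fun f s => sweedler_comm f D.e s
  simp only [hE, D.act_act, ← antipode_mul_antidistrib]
  conv_lhs =>
    enter [1, ℓ₁, w]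
    rw [sweedler_comm]
  simp (disch := fun_prop) only [sw_coassoc]
  have h1 : ∀ (c v : L), sweedler (fun d w => sweedler (fun a₁ b₁ => sweedler (fun c₁ d₁ =>
      sweedler (fun e₁ e₂ => tm D (D.act e₂ (antipode k (antipode k d * a₁)) * e₁)
        (antipode k c * c₁) (D.act a d₁ * b)) D.e) (comul (R := k) b₁)) (comul (R := k) w))
      (comul (R := k) v) = sweedler (fun c₁ d₁ => tm D 1 (antipode k c * c₁) (D.act a d₁ * b))
        (comul (R := k) v) := by
    intro c v
    rw [← sw_coassoc (by fun_prop) (by fun_prop) (by fun_prop)]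
    have h : ∀ (u w : L), sweedler (fun d a₁ => sweedler (fun c₁ d₁ =>
      sweedler (fun e₁ e₂ => tm D (D.act e₂ (antipode k (antipode k d * a₁)) * e₁)
        (antipode k c * c₁) (D.act a d₁ * b)) D.e) (comul (R := k) w)) (comul (R := k) u) =
        counit (R := k) u • sweedler (fun c₁ d₁ =>
          tm D 1 (antipode k c * c₁) (D.act a d₁ * b)) (comul (R := k) w) := by
      intro u w
      rw [sw_antipode_l (f := fun t => sweedler (fun c₁ d₁ =>
        sweedler (fun e₁ e₂ => tm D (D.act e₂ (antipode k t) * e₁)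
        (antipode k c * c₁) (D.act a d₁ * b)) D.e) (comul (R := k) w)) (by fun_prop)]
      simp only [antipode_one, D.act_one]
      congr 2; funext c₁ d₁
      rw [D.sw_e_symm (by fun_prop) (by fun_prop)]
      exact D.sw_e_one (f := fun s => tm D s (antipode k c * c₁) (D.act a d₁ * b)) (by fun_prop)
    simp only [h]
    exact sw_counit_l (f := fun w => sweedler (fun c₁ d₁ =>
          tm D 1 (antipode k c * c₁) (D.act a d₁ * b)) (comul (R := k) w)) (by fun_prop) v
  simp only [h1]
  rw [← sw_coassoc (by fun_prop) (by fun_prop) (by fun_prop)]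
  have h2 : ∀ u z : L, sweedler (fun x y => tm D 1 (antipode k x * y) (D.act a z * b))
      (comul (R := k) u) = counit (R := k) u • tm D 1 1 (D.act a z * b) := fun u z =>
    sw_antipode_l (f := fun t => tm D 1 t (D.act a z * b)) (by fun_prop) u
  simp only [h2]
  exact sw_counit_l (f := fun z => tm D 1 1 (D.act a z * b)) (by fun_prop) ℓ

theorem mul_antipodeMap (x : QTG D) :
    sweedler (fun u v => u * antipodeMap D v) (comulMap D x) =
      sweedler (fun u v => counitMap D (u * x) • v) (comulMap D 1) := by
  revert x
  refine lin_ext (k := k) (by fun_prop) (by fun_prop) fun a ℓ b => ?_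
  rw [target_tm]
  simp (disch := fun_prop) only [comulMap_tm, sweedler_sweedler, sweedler_tmul, antipodeMap_tm,
    tm_mul_tm, sw_antipode]
  have hE : ∀ (f : B → B → L → L → QTG D) s, _ := fun f s => sweedler_comm f D.e s
  have hE' : ∀ (f : L → L → B → B → QTG D) s, _ := fun f s => sweedler_comm f s D.e
  simp only [hE]
  have h1 : ∀ (ℓ₁ ℓ₂ y t : L) (e₁ e₂ : B), sweedler (fun p x =>
      tm D (D.act b (antipode k ℓ₁) * a) (ℓ₂ * antipode k y)
        (D.act e₁ (antipode k x) * D.act e₂ (antipode k p))) (comul (R := k) t) =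
      tm D (D.act b (antipode k ℓ₁) * a) (ℓ₂ * antipode k y)
        (D.act (e₁ * e₂) (antipode k t)) := fun ℓ₁ ℓ₂ y t e₁ e₂ =>
    sw_act_antipode_mul D (F := fun s => tm D (D.act b (antipode k ℓ₁) * a)
      (ℓ₂ * antipode k y) s) (by fun_prop) e₁ e₂ t
  have h2 : ∀ (ℓ₁ ℓ₂ y t : L), sweedler (fun e₁ e₂ =>
      tm D (D.act b (antipode k ℓ₁) * a) (ℓ₂ * antipode k y)
        (D.act (e₁ * e₂) (antipode k t))) D.e = counit (R := k) t •
      tm D (D.act b (antipode k ℓ₁) * a) (ℓ₂ * antipode k y) 1 := by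
    intro ℓ₁ ℓ₂ y t
    rw [D.sw_e_one (f := fun s => tm D (D.act b (antipode k ℓ₁) * a) (ℓ₂ * antipode k y)
      (D.act s (antipode k t))) (by fun_prop), D.one_act, counit_antipode, tm_smul₃]
  conv_lhs =>
    enter [1, u, v]
    rw [sweedler_comm]
  simp (disch := fun_prop) only [sw_coassoc]
  have h3 : ∀ (c d v : L), sweedler (fun a₂ b₂ => sweedler (fun c₁ d₁ =>
      sweedler (fun e₁ e₂ => tm D (D.act b (antipode k c) * a) (d * antipode k d₁)
        (D.act e₁ (antipode k c₁) * D.act e₂ (antipode k a₂))) D.e) (comul (R := k) b₂))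
      (comul (R := k) v) = tm D (D.act b (antipode k c) * a) (d * antipode k v) 1 := by
    intro c d v
    rw [← sw_coassoc (by fun_prop) (by fun_prop) (by fun_prop)]
    simp only [hE', h1, h2]
    exact sw_counit_l (f := fun w => tm D (D.act b (antipode k c) * a) (d * antipode k w) 1)
      (by fun_prop) v
  simp only [h3]
  have h4 : ∀ c v : L, sweedler (fun d w => tm D (D.act b (antipode k c) * a)
      (d * antipode k w) 1) (comul (R := k) v) = counit (R := k) v •
        tm D (D.act b (antipode k c) * a) 1 1 := fun c v =>
    sw_antipode_r (f := fun t => tm D (D.act b (antipode k c) * a) t 1) (by fun_prop) v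
  simp only [h4]
  exact sw_counit_r (f := fun c => tm D (D.act b (antipode k c) * a) 1 1) (by fun_prop) ℓ

theorem antipodeMap_mul_antipodeMap (x : QTG D) :
    sweedler (fun u w => sweedler (fun v z => antipodeMap D u * v * antipodeMap D z)
      (comulMap D w)) (comulMap D x) = antipodeMap D x := by
  have h := sw_coassoc (k := k) (f := fun u v z => antipodeMap D u * v * antipodeMap D z)
    (by fun_prop) (by fun_prop) (by fun_prop) x
  simp only [comul_eq, ← sweedler_mul, antipodeMap_mul] at h
  rw [← h]
  clear h
  revert x
  refine lin_ext (k := k) (by fun_prop) (by fun_prop) fun a ℓ b => ?_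
  simp (disch := fun_prop) only [comulMap_tm, sweedler_sweedler, sweedler_tmul, antipodeMap_tm,
    source_tm, tm_one_mul_tm, sw_antipode]
  have hE : ∀ (f : B → B → L → L → QTG D) s, _ := fun f s => sweedler_comm f D.e s
  simp only [hE]
  have h : ∀ a₁ v : L, sweedler (fun a₂ b₂ => sweedler (fun x y => sweedler (fun e₁ e₂ =>
      tm D b (antipode k y) (D.act (D.act a a₁ * e₁) (antipode k x) * D.act e₂ (antipode k a₂)))
      D.e) (comul (R := k) b₂)) (comul (R := k) v) =
      sweedler (fun t y => tm D b (antipode k y) (D.act a (a₁ * antipode k t)))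
        (comul (R := k) v) := by
    intro a₁ v
    rw [← sw_coassoc (by fun_prop) (by fun_prop) (by fun_prop)]
    congr 1; funext t y
    rw [← sweedler_comm]
    have : ∀ e₁ e₂ : B, sweedler (fun a₂ x => tm D b (antipode k y)
        (D.act (D.act a a₁ * e₁) (antipode k x) * D.act e₂ (antipode k a₂))) (comul (R := k) t) =
        tm D b (antipode k y) (D.act (D.act a a₁ * e₁ * e₂) (antipode k t)) := fun e₁ e₂ =>
      sw_act_antipode_mul D (F := fun s => tm D b (antipode k y) s) (by fun_prop) _ _ t
    simp only [this, mul_assoc]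
    rw [D.sw_e_one (f := fun s => tm D b (antipode k y) (D.act (D.act a a₁ * s) (antipode k t)))
      (by fun_prop), mul_one, D.act_act]
  simp only [h]
  rw [← sw_coassoc (by fun_prop) (by fun_prop) (by fun_prop)]
  have h' : ∀ u z : L, sweedler (fun x y => tm D b (antipode k z) (D.act a (x * antipode k y)))
      (comul (R := k) u) = counit (R := k) u • tm D b (antipode k z) a := by
    intro u z
    rw [sw_antipode_r (f := fun t => tm D b (antipode k z) (D.act a t)) (by fun_prop), D.act_one]
  simp only [h']
  exact sw_counit_l (f := fun z => tm D b (antipode k z) a) (by fun_prop) ℓ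

noncomputable instance instWeakHopfAlgebra : WeakHopfAlgebra k (QTG D) where
  comul_mul' := comulMap_mul D
  counit_mul_left := counitMap_mul_left D
  counit_mul_right := counitMap_mul_right D
  comul_one_left := comulMap_one_left D
  comul_one_right := comulMap_one_right D
  antipode := antipodeMap D
  antipode_mul := antipodeMap_mul D
  mul_antipode := mul_antipodeMap D
  antipode_mul_antipode := antipodeMap_mul_antipodeMap D

end QTG

/-! ### Integrals -/

/-- `Λ` is a right integral of the Hopf algebra `L` if `Λℓ = ε(ℓ)Λ` for all `ℓ`. -/
def HopfIsRightIntegral (k : Type*) {L : Type*} [Field k] [Ring L] [HopfAlgebra k L] (Λ : L) :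
    Prop :=
  ∀ ℓ : L, Λ * ℓ = counit (R := k) ℓ • Λ

/-- The element `(e¹ ◁ Λ₁) ⊗ S(Λ₂) ⊗ e²` of `H(L, B)`. -/
noncomputable def QTG.integral {k L B : Type*} [Field k] [Ring L] [HopfAlgebra k L] [Ring B]
    [Algebra k B] (D : TransformationDatum k L B) (Λ : L) : QTG D :=
  sweedler (fun e₁ e₂ => sweedler (fun Λ₁ Λ₂ =>
    QTG.tm D (D.act e₁ Λ₁) (antipode k Λ₂) e₂) (comul (R := k) Λ)) D.e

/-!
Write `N = S(Λ)`, a left integral of `L`, and let `θ` be the linear automorphism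
`a ⊗ ℓ ⊗ b ↦ a ⊗ ℓ₁ ⊗ (b ◁ ℓ₂)` of `H(L, B)`. Then `Λ̄ = θ(e¹ ⊗ N ⊗ e²)`, and `θ` untwists the
coalgebra structure: `Δ(θ(a ⊗ ℓ ⊗ b)) = θ(a ⊗ ℓ₁ ⊗ f¹) ⊗ θ(f² ⊗ ℓ₂ ⊗ b)`, where `f = e`.

* Integral: `(1 ⊗ 1 ⊗ b)Λ̄ = (b ⊗ 1 ⊗ 1)Λ̄` because `e` is a separability idempotent, and
  `(1 ⊗ ℓ ⊗ 1)Λ̄ = ε(ℓ)Λ̄` because `N` is a left integral and `S²` acts trivially on `B`. So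
  `(a ⊗ ℓ ⊗ b)Λ̄ = ((b ◁ S(ℓ))a ⊗ 1 ⊗ 1)Λ̄`.
* Non-degeneracy: up to `θ`, the tensor `Δ(Λ̄)` is made of two copies of `e` and of `N₁ ⊗ N₂`.
  Pairing with the trace form removes the copies of `e`, which leaves the classical fact that
  `ψ ↦ N₁ψ(N₂)` is injective on `L*`.
-/

/-- `N` is a left integral of the Hopf algebra `L` if `ℓN = ε(ℓ)N` for all `ℓ`. -/
def HopfIsLeftIntegral (k : Type*) {L : Type*} [Field k] [Ring L] [HopfAlgebra k L] (N : L) :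
    Prop :=
  ∀ ℓ : L, ℓ * N = counit (R := k) ℓ • N

namespace Sweedler

theorem eq_zero_of_forall_sweedler_apply_smul {k U V : Type*} [Field k] [AddCommGroup U]
    [Module k U] [AddCommGroup V] [Module k V] {t : U ⊗[k] Module.Dual k V}
    (h : ∀ v, sweedler (fun u χ => χ v • u) t = 0) : t = 0 := by
  let b := Module.Free.chooseBasis k U
  obtain ⟨c, rfl⟩ := TensorProduct.eq_repr_basis_left b t
  suffices hc : c = 0 by rw [hc, Finsupp.sum_zero_index]
  ext i v
  have hv : c.sum (fun j χ => χ v • b j) = 0 := by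
    rw [← h v, sweedler_eq_lift (by fun_prop) (by fun_prop), map_finsuppSum]
    rfl
  have hli := linearIndependent_iff.1 b.linearIndependent
    (c.mapRange (fun χ => χ v) (LinearMap.zero_apply v))
    (by rw [Finsupp.linearCombination_apply, Finsupp.sum_mapRange_index (by simp), hv])
  exact DFunLike.congr_fun hli i

theorem sweedler_zero {k U V M : Type*} [Field k] [AddCommGroup U] [Module k U] [AddCommGroup V]
    [Module k V] [AddCommGroup M] [Module k M] {f : U → V → M}
    (h1 : ∀ v, IsLinearMap k (fun u => f u v)) (h2 : ∀ u, IsLinearMap k (fun v => f u v)) :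
    sweedler f (0 : U ⊗[k] V) = 0 := by
  rw [sweedler_eq_lift h1 h2, map_zero]

theorem sw_coassoc_middle {k C M : Type*} [Field k] [AddCommGroup C] [Module k C] [Coalgebra k C]
    [AddCommGroup M] [Module k M] {f : C → C → C → C → M}
    (h1 : ∀ y z w, IsLinearMap k (fun x => f x y z w))
    (h2 : ∀ x z w, IsLinearMap k (fun y => f x y z w))
    (h3 : ∀ x y w, IsLinearMap k (fun z => f x y z w))
    (h4 : ∀ x y z, IsLinearMap k (fun w => f x y z w)) (c : C) :
    sweedler (fun u w => sweedler (fun x v => sweedler (fun y z => f x y z w)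
      (comul (R := k) v)) (comul (R := k) u)) (comul (R := k) c) =
      sweedler (fun u v => sweedler (fun x y => sweedler (fun z w => f x y z w)
        (comul (R := k) v)) (comul (R := k) u)) (comul (R := k) c) := by
  rw [sw_coassoc (by fun_prop) (by fun_prop) (by fun_prop),
    sw_coassoc (by fun_prop) (by fun_prop) (by fun_prop)]
  congr 1; funext x v
  exact sw_coassoc (by fun_prop) (by fun_prop) (by fun_prop) v

variable {k L M : Type*} [Field k] [Ring L] [HopfAlgebra k L] [AddCommGroup M] [Module k M]

theorem sw_antipode_mul_fst {f : L → L → M} (h1 : ∀ y, IsLinearMap k (fun x => f x y))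
    (h2 : ∀ x, IsLinearMap k (fun y => f x y)) (ℓ : L) :
    sweedler (fun u z => sweedler (fun x y => f (antipode k x * y) z) (comul (R := k) u))
      (comul (R := k) ℓ) = f 1 ℓ := by
  simp only [fun u z => sw_antipode_l (h1 z) u]
  exact sw_counit_l (h2 1) ℓ

theorem sw_antipode_mul_snd {f : L → L → M} (h1 : ∀ y, IsLinearMap k (fun x => f x y))
    (h2 : ∀ x, IsLinearMap k (fun y => f x y)) (ℓ : L) :
    sweedler (fun u z => sweedler (fun x y => f x (antipode k y * z)) (comul (R := k) u))
      (comul (R := k) ℓ) = f ℓ 1 := by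
  rw [sw_coassoc (by fun_prop) (by fun_prop) (by fun_prop)]
  simp only [fun x v => sw_antipode_l (h2 x) v]
  exact sw_counit_r (h1 1) ℓ

end Sweedler

section HopfIntegral

open Sweedler

variable {k L M : Type*} [Field k] [Ring L] [HopfAlgebra k L] [AddCommGroup M] [Module k M]

theorem HopfIsRightIntegral.antipode [FiniteDimensional k L] {Λ : L}
    (hΛ : HopfIsRightIntegral k Λ) : HopfIsLeftIntegral k (antipode k Λ) := by
  intro ℓ
  obtain ⟨m, rfl⟩ := (antipode_bijective (k := k) (L := L)).2 ℓ
  rw [← antipode_mul_antidistrib, hΛ m, map_smul, counit_antipode]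

namespace HopfIsLeftIntegral

variable {N : L}

theorem sw_antipode_mul (hN : HopfIsLeftIntegral k N) {f : L → L → M}
    (h1 : ∀ y, IsLinearMap k (fun x => f x y)) (h2 : ∀ x, IsLinearMap k (fun y => f x y)) (ℓ : L) :
    sweedler (fun x y => f (antipode k ℓ * x) y) (comul (R := k) N) =
      sweedler (fun x y => f x (ℓ * y)) (comul (R := k) N) := by
  let g : L → L → M := fun ℓ n =>
    sweedler (fun x y => f (antipode k ℓ * x) y) (comul (R := k) n)
  have hg : ∀ ℓ, IsLinearMap k (g ℓ) := fun ℓ => by fun_prop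
  calc g ℓ N
      = sweedler (fun ℓ₁ ℓ₂ => counit (R := k) ℓ₂ • g ℓ₁ N) (comul (R := k) ℓ) :=
        (sw_counit_r (f := fun ℓ => g ℓ N) (by fun_prop) ℓ).symm
    _ = sweedler (fun ℓ₁ ℓ₂ => g ℓ₁ (ℓ₂ * N)) (comul (R := k) ℓ) := by
        simp only [hN _, (hg _).map_smul]
    _ = sweedler (fun u z => sweedler (fun x y => sweedler (fun n₁ n₂ =>
          f (antipode k x * y * n₁) (z * n₂)) (comul (R := k) N)) (comul (R := k) u))
          (comul (R := k) ℓ) := by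
        rw [sw_coassoc (by fun_prop) (by fun_prop) (by fun_prop)]
        simp (disch := fun_prop) only [g, sw_mul, mul_assoc]
    _ = sweedler (fun x y => f x (ℓ * y)) (comul (R := k) N) := by
        rw [sw_antipode_mul_fst (f := fun s t => sweedler (fun n₁ n₂ => f (s * n₁) (t * n₂))
          (comul (R := k) N)) (by fun_prop) (by fun_prop)]
        simp only [one_mul]

theorem dual_eq_zero (hN : HopfIsLeftIntegral k N) (h0 : N ≠ 0) {ψ : Module.Dual k L}
    (hψ : sweedler (fun x y => ψ y • x) (comul (R := k) N) = 0) : ψ = 0 := by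
  let Φ : L →ₗ[k] Module.Dual k L := (LinearMap.mul k L).flip.compr₂ ψ
  have hΦ : sweedler (fun x y => x ⊗ₜ[k] Φ y) (comul (R := k) N) = 0 := by
    refine eq_zero_of_forall_sweedler_apply_smul fun ℓ => ?_
    simp (disch := fun_prop) only [sweedler_sweedler, sweedler_tmul]
    change sweedler (fun x y => ψ (ℓ * y) • x) (comul (R := k) N) = 0
    rw [← hN.sw_antipode_mul (f := fun x y => ψ y • x) (by fun_prop) (by fun_prop)]
    simp only [← mul_smul_comm, ← mul_sweedler, hψ, mul_zero]
  ext m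
  have hm := congrArg (sweedler fun x χ => sweedler (fun x₁ x₂ => χ (m * antipode k x₂) • x₁)
    (comul (R := k) x)) hΦ
  simp (disch := fun_prop) only [sweedler_sweedler, sweedler_tmul] at hm
  have hψN : ψ m • N = 0 := by
    calc ψ m • N
        = sweedler (fun u z => sweedler (fun x y => ψ (m * (antipode k y * z)) • x)
            (comul (R := k) u)) (comul (R := k) N) := by
          rw [sw_antipode_mul_snd (f := fun x t => ψ (m * t) • x) (by fun_prop) (by fun_prop),
            mul_one]
      _ = 0 := by
          simp only [← mul_assoc]
          exact hm.trans (sweedler_zero (by fun_prop) (by fun_prop))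
  exact (smul_eq_zero.1 hψN).resolve_right h0

end HopfIsLeftIntegral

end HopfIntegral

namespace QTG

open Sweedler

variable {k L B : Type*} [Field k] [Ring L] [HopfAlgebra k L] [Ring B] [Algebra k B]
  (D : TransformationDatum k L B)

section Twist

/-- The linear map `θ : a ⊗ ℓ ⊗ b ↦ a ⊗ ℓ₁ ⊗ (b ◁ ℓ₂)` of `H(L, B)`, which untwists its
coalgebra structure (`comulMap_twist_tm`). -/
noncomputable def twist : QTG D →ₗ[k] QTG D :=
  lift3 D (fun a ℓ b => sweedler (fun x y => tm D a x (D.act b y)) (comul (R := k) ℓ))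
    (by fun_prop) (by fun_prop) (by fun_prop)

theorem twist_tm (a b : B) (ℓ : L) : twist D (tm D a ℓ b) =
    sweedler (fun x y => tm D a x (D.act b y)) (comul (R := k) ℓ) := by
  rw [twist, lift3_tm]

theorem tm_op_mul_twist_tm (a b c : B) (ℓ : L) :
    tm D c 1 1 * twist D (tm D a ℓ b) = twist D (tm D (a * c) ℓ b) := by
  simp only [twist_tm, mul_sweedler, tm_op_mul_tm]

theorem tm_one_mul_twist_tm (a b c : B) (ℓ : L) :
    tm D 1 1 c * twist D (tm D a ℓ b) = twist D (tm D a ℓ (c * b)) := by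
  simp only [twist_tm, mul_sweedler, tm_one_mul_tm, D.mul_act, tm_sweedler₃]
  exact sw_coassoc (by fun_prop) (by fun_prop) (by fun_prop) ℓ

theorem comulMap_twist_tm (a b : B) (ℓ : L) : comulMap D (twist D (tm D a ℓ b)) =
    sweedler (fun x y => sweedler (fun f₁ f₂ => twist D (tm D a x f₁) ⊗ₜ[k] twist D (tm D f₂ y b))
      D.e) (comul (R := k) ℓ) := by
  have hact : ∀ x p q : L, ∀ c : B, sweedler (fun f₁ f₂ => tm D a x f₁ ⊗ₜ[k]
      tm D (D.act f₂ (antipode k p)) q c) D.e = sweedler (fun f₁ f₂ =>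
      tm D a x (D.act f₁ p) ⊗ₜ[k] tm D f₂ q c) D.e := fun x p q c =>
    (D.sw_act_e (f := fun f₁ f₂ => tm D a x f₁ ⊗ₜ[k] tm D f₂ q c)
      (by fun_prop) (by fun_prop) p).symm
  simp only [twist_tm, lm_sweedler, comulMap_tm, hact]
  rw [sw_coassoc_middle (by fun_prop) (by fun_prop) (by fun_prop) (by fun_prop)]
  congr 1; funext u v
  simp only [sweedler_tmul']
  simp only [tmul_sweedler]
  rw [sweedler_comm _ D.e]
  congr 1; funext x p
  exact sweedler_comm ..

theorem twist_surjective [FiniteDimensional k B] : Function.Surjective (twist D) := by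
  intro z
  induction z using induction_tm with
  | h0 => exact ⟨0, map_zero _⟩
  | hadd z w hz hw =>
    obtain ⟨z', rfl⟩ := hz
    obtain ⟨w', rfl⟩ := hw
    exact ⟨z' + w', map_add _ _ _⟩
  | h a ℓ b =>
    refine ⟨sweedler (fun x y => tm D a x (D.act b (antipode k y))) (comul (R := k) ℓ), ?_⟩
    have hact : ∀ y z : L, D.act (D.act b (antipode k z)) y =
        D.act b (antipode k (antipode k y * z)) := fun y z => by
      rw [antipode_mul_antidistrib, ← D.act_act, D.act_antipode_antipode]
    simp only [lm_sweedler, twist_tm, hact]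
    rw [sw_antipode_mul_snd (f := fun x t => tm D a x (D.act b (antipode k t)))
      (by fun_prop) (by fun_prop), antipode_one, D.act_one]

instance instFiniteDimensional [FiniteDimensional k L] [FiniteDimensional k B] :
    FiniteDimensional k (QTG D) :=
  inferInstanceAs (FiniteDimensional k (Bᵐᵒᵖ ⊗[k] (L ⊗[k] B)))

theorem twist_injective [FiniteDimensional k L] [FiniteDimensional k B] :
    Function.Injective (twist D) :=
  LinearMap.injective_iff_surjective.2 (twist_surjective D)

end Twist

/-- The element `e¹ ⊗ N₁ ⊗ (e² ◁ N₂)` of `H(L, B)`, which is a left integral if `N` is one. -/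
noncomputable def leftIntegral (N : L) : QTG D :=
  sweedler (fun e₁ e₂ => twist D (tm D e₁ N e₂)) D.e

theorem integral_eq_leftIntegral (Λ : L) : integral D Λ = leftIntegral D (antipode k Λ) := by
  simp (disch := fun_prop) only [integral, leftIntegral, twist_tm, sw_antipode]
  rw [sweedler_comm, sweedler_comm _ D.e]
  congr 1; funext x y
  exact D.sw_act_e (f := fun e₁ e₂ => tm D e₁ (antipode k y) e₂) (by fun_prop) (by fun_prop) x

section IsLeftIntegral

theorem tm_right_mul_leftIntegral (b : B) (N : L) :
    tm D 1 1 b * leftIntegral D N = tm D b 1 1 * leftIntegral D N := by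
  simp only [leftIntegral, mul_sweedler, tm_one_mul_twist_tm, tm_op_mul_twist_tm]
  exact (D.sw_e_mul (f := fun e₁ e₂ => twist D (tm D e₁ N e₂)) (by fun_prop) (by fun_prop) b).symm

variable [FiniteDimensional k L] [FiniteDimensional k B] {N : L}

theorem tm_middle_mul_leftIntegral (hN : HopfIsLeftIntegral k N) (ℓ : L) :
    tm D 1 ℓ 1 * leftIntegral D N = counit (R := k) ℓ • leftIntegral D N := by
  obtain ⟨m', rfl⟩ := (antipode_bijective (k := k) (L := L)).2 ℓ
  obtain ⟨m, rfl⟩ := (antipode_bijective (k := k) (L := L)).2 m'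
  let g : L → QTG D := fun t => sweedler (fun e₁ e₂ => sweedler (fun n₁ n₂ =>
    tm D e₁ (t * n₁) (D.act e₂ n₂)) (comul (R := k) N)) D.e
  have hg : ∀ x t : L, sweedler (fun e₁ e₂ => sweedler (fun n₁ n₂ =>
      tm D (D.act e₁ (antipode k x)) (t * n₁) (D.act e₂ n₂)) (comul (R := k) N)) D.e =
      g (t * antipode k x) := by
    intro x t
    rw [D.sw_act_e' (f := fun e₁ e₂ => sweedler (fun n₁ n₂ => tm D e₁ (t * n₁) (D.act e₂ n₂))
      (comul (R := k) N)) (by fun_prop) (by fun_prop)]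
    simp only [g, D.act_act, mul_assoc]
    congr 1; funext e₁ e₂
    exact (hN.sw_antipode_mul (f := fun n₁ n₂ => tm D e₁ (t * n₁) (D.act e₂ n₂))
      (by fun_prop) (by fun_prop) x).symm
  calc tm D 1 (antipode k (antipode k m)) 1 * leftIntegral D N
      = sweedler (fun x y => g (antipode k (antipode k y) * antipode k x))
          (comul (R := k) m) := by
        simp (disch := fun_prop) only [← hg, leftIntegral, twist_tm, mul_sweedler, tm_mul_tm_left,
          mul_one, sw_antipode, D.act_antipode_antipode]
        simp only [fun e₁ e₂ => sweedler_comm (fun n₁ n₂ x y => tm D (D.act e₁ (antipode k x))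
          (antipode k (antipode k y) * n₁) (D.act e₂ n₂)) (comul (R := k) N) (comul (R := k) m)]
        exact sweedler_comm ..
    _ = counit (R := k) m • g 1 := by
        simp only [← antipode_mul_antidistrib]
        rw [sw_antipode_r (f := fun t => g (antipode k t)) (by fun_prop), antipode_one]
    _ = counit (R := k) (antipode k (antipode k m)) • leftIntegral D N := by
        simp only [g, one_mul, counit_antipode, leftIntegral, twist_tm]

theorem tm_mul_leftIntegral (hN : HopfIsLeftIntegral k N) (a b : B) (ℓ : L) :
    tm D a ℓ b * leftIntegral D N = tm D (D.act b (antipode k ℓ) * a) 1 1 * leftIntegral D N := by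
  have hfactor : tm D a ℓ b = tm D a 1 1 * (tm D 1 ℓ 1 * tm D 1 1 b) := by
    rw [tm_mul_tm_right]
    simp (disch := fun_prop) only [sw_one, D.act_one, tm_op_mul_tm, mul_one, one_mul]
  have hcomm : tm D 1 ℓ 1 * tm D b 1 1 =
      sweedler (fun x y => tm D (D.act b (antipode k x)) 1 1 * tm D 1 y 1) (comul (R := k) ℓ) := by
    simp only [tm_mul_tm_one, tm_op_mul_tm, mul_one, one_mul]
  calc tm D a ℓ b * leftIntegral D N
      = tm D a 1 1 * (tm D 1 ℓ 1 * tm D b 1 1 * leftIntegral D N) := by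
        rw [hfactor, mul_assoc, mul_assoc, tm_right_mul_leftIntegral, ← mul_assoc (tm D 1 ℓ 1)]
    _ = tm D a 1 1 * (tm D (D.act b (antipode k ℓ)) 1 1 * leftIntegral D N) := by
        simp only [hcomm, sweedler_mul, mul_assoc, tm_middle_mul_leftIntegral D hN,
          mul_smul_comm]
        rw [sw_counit_r (f := fun x => tm D (D.act b (antipode k x)) 1 1 * leftIntegral D N)
          (by fun_prop)]
    _ = tm D (D.act b (antipode k ℓ) * a) 1 1 * leftIntegral D N := by
        rw [← mul_assoc, tm_op_mul_tm]

theorem isLeftIntegral_leftIntegral (hN : HopfIsLeftIntegral k N) :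
    WeakHopfAlgebra.IsLeftIntegral k (leftIntegral D N) := by
  refine lin_ext (k := k) (by fun_prop) ?_ fun a ℓ b => ?_
  · simp only [WeakHopfAlgebra.targetCounital, comul_eq, counit_eq]
    fun_prop
  · rw [tm_mul_leftIntegral D hN, ← target_tm]
    rfl

end IsLeftIntegral

section IsNondegenerate

variable [FiniteDimensional k B]

/-- The linear map `a ⊗ ℓ ⊗ b ↦ ω(ya) ω(xb) ℓ`, which strips the two copies of the separability
idempotent off the comultiplication of `leftIntegral D N`. -/
noncomputable def contraction (x y : B) : QTG D →ₗ[k] L :=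
  lift3 D (fun a ℓ b => D.traceForm (y * a) • D.traceForm (x * b) • ℓ)
    (by fun_prop) (by fun_prop) (by fun_prop)

theorem contraction_tm (x y a b : B) (ℓ : L) : contraction D x y (tm D a ℓ b) =
    D.traceForm (y * a) • D.traceForm (x * b) • ℓ := by
  rw [contraction, lift3_tm]

variable [FiniteDimensional k L]

theorem integralMap_leftIntegral (N : L) (φ : Module.Dual k (QTG D)) :
    WeakHopfAlgebra.integralMap k (leftIntegral D N) φ =
      twist D (sweedler (fun e₁ e₂ => sweedler (fun x y => sweedler (fun f₁ f₂ =>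
        φ (twist D (tm D f₂ y e₂)) • tm D e₁ x f₁) D.e) (comul (R := k) N)) D.e) := by
  simp (disch := fun_prop) only [WeakHopfAlgebra.integralMap, comul_eq, leftIntegral, lm_sweedler,
    comulMap_twist_tm, sweedler_sweedler, sweedler_tmul, map_smul]

theorem sw_dual_smul_eq_zero {N : L} {φ : Module.Dual k (QTG D)}
    (hφ : WeakHopfAlgebra.integralMap k (leftIntegral D N) φ = 0) (x y : B) :
    sweedler (fun n₁ n₂ => φ (twist D (tm D x n₂ y)) • n₁) (comul (R := k) N) = 0 := by
  rw [integralMap_leftIntegral] at hφ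
  have h := congrArg (contraction D x y) (twist_injective D (hφ.trans (map_zero _).symm))
  simp only [lm_sweedler, map_smul, contraction_tm, map_zero] at h
  rw [sweedler_comm] at h
  rw [← h]
  congr 1; funext n₁ n₂
  have hf : ∀ e₁ e₂, sweedler (fun f₁ f₂ => φ (twist D (tm D f₂ n₂ e₂)) •
      D.traceForm (y * e₁) • D.traceForm (x * f₁) • n₁) D.e =
      D.traceForm (y * e₁) • φ (twist D (tm D x n₂ e₂)) • n₁ := by
    intro e₁ e₂
    simp only [smul_comm _ (D.traceForm (x * _))]
    rw [D.sw_trace_mul (f := fun a => φ (twist D (tm D a n₂ e₂)) • D.traceForm (y * e₁) • n₁)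
      (by fun_prop), smul_comm]
  simp only [hf]
  exact (D.sw_trace_mul (f := fun b => φ (twist D (tm D x n₂ b)) • n₁) (by fun_prop) y).symm

theorem isNondegenerate_leftIntegral {N : L} (hN : HopfIsLeftIntegral k N) (h0 : N ≠ 0) :
    WeakHopfAlgebra.IsNondegenerate k (leftIntegral D N) := by
  let Ψ : Module.Dual k (QTG D) →ₗ[k] QTG D := IsLinearMap.mk'
    (WeakHopfAlgebra.integralMap k (leftIntegral D N))
    (lin_sweedler_f (fun u v => lin_smul_l (lin_app lin_id v) u) _)
  have hinj : Function.Injective Ψ := by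
    rw [← LinearMap.ker_eq_bot, LinearMap.ker_eq_bot']
    intro φ hφ
    have hφθ : ∀ z, φ (twist D z) = 0 := lin_ext (ψ := fun _ => (0 : k)) (by fun_prop)
      (0 : QTG D →ₗ[k] k).isLinear fun a ℓ b => LinearMap.congr_fun
        (hN.dual_eq_zero h0 (ψ := IsLinearMap.mk' (fun ℓ => φ (twist D (tm D a ℓ b)))
          (by fun_prop)) (sw_dual_smul_eq_zero D hφ a b)) ℓ
    exact LinearMap.ext ((twist_surjective D).forall.2 hφθ)
  exact ⟨hinj, (LinearMap.injective_iff_surjective_of_finrank_eq_finrank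
    (Subspace.dual_finrank_eq (K := k) (V := QTG D))).1 hinj⟩

end IsNondegenerate

end QTG

theorem proposition5p7_general {k L B : Type*} [Field k]
    [Ring L] [HopfAlgebra k L] [FiniteDimensional k L]
    [Ring B] [Algebra k B] [FiniteDimensional k B]
    (D : TransformationDatum k L B) (Λ : L) (hΛ : HopfIsRightIntegral k Λ) :
    WeakHopfAlgebra.IsLeftIntegral k (QTG.integral D Λ) ∧
      (Λ ≠ 0 → WeakHopfAlgebra.IsNondegenerate k (QTG.integral D Λ)) := by
  rw [QTG.integral_eq_leftIntegral]
  refine ⟨QTG.isLeftIntegral_leftIntegral D hΛ.antipode, fun hΛ0 =>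
    QTG.isNondegenerate_leftIntegral D hΛ.antipode ?_⟩
  exact (map_ne_zero_iff _ Sweedler.antipode_bijective.1).2 hΛ0

theorem proposition5p7 {k L B : Type*} [Field k] [CharZero k]
    [Ring L] [HopfAlgebra k L] [FiniteDimensional k L]
    [Ring B] [Algebra k B] [FiniteDimensional k B]
    (D : TransformationDatum k L B) (Λ : L) (hΛ : HopfIsRightIntegral k Λ) :
    WeakHopfAlgebra.IsLeftIntegral k (QTG.integral D Λ) ∧
      (Λ ≠ 0 → WeakHopfAlgebra.IsNondegenerate k (QTG.integral D Λ)) :=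
  proposition5p7_general D Λ hΛ
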